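/- Let $k$ be a commutative ring and let $d\ge 0$ be an integer. For a $k$-module $M$ put $\Gamma^d(M):=(M^{\otimes d})^{S_d}$, where the symmetric group $S_d$ permutes the tensor factors. Let $\Gamma^dP_k$ be the category whose objects are the finitely generated projective $k$-modules, with morphisms $\operatorname{Hom}_{\Gamma^dP_k}(V,W):=\Gamma^d(\operatorname{Hom}_k(V,W))$ and with composition induced by factorwise composition of linear maps. The tensor product of modules, together with factorwise tensor product of linear maps, gives a bifunctor $(V,W)\mapsto V\otimes W$ on $\Gamma^dP_k$. Let $\operatorname{Rep}\Gamma^d_k$ be the category of strict polynomial functors of degree $d$, i.e. of $k$-linear functors $\Gamma^dP_k\to k\text{-Mod}$ and natural transformations. For $V$ in $\Gamma^dP_k$ let $\Gamma^{d,V}:=\operatorname{Hom}_{\Gamma^dP_k}(V,-)$ be the representable functor. For $X,Y$ in $\operatorname{Rep}\Gamma^d_k$ the internal tensor product is $$X\,\underline{\otimes}\,Y:=\operatorname*{colim}_{\Gamma^{d,V}\to X}\ \operatorname*{colim}_{\Gamma^{d,W}\to Y}\ \Gamma^{d,V\otimes W},$$ where the colimits run over the categories of morphisms from representable functors to $X$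 and to $Y$. Let $\mathrm{Sym}^d$ and $\wedge^d$ denote the strict polynomial functors $V\mapsto \mathrm{Sym}^d(V)$ and $V\mapsto\wedge^d(V)$, on which an element of $\Gamma^d(\operatorname{Hom}_k(V,W))$ acts through the map $V^{\otimes d}\to W^{\otimes d}$ that it defines. Then there are isomorphisms in $\operatorname{Rep}\Gamma^d_k$ $$\wedge^d\,\underline{\otimes}\,\wedge^d\simeq \mathrm{Sym}^d,\qquad \mathrm{Sym}^d\,\underline{\otimes}\,\mathrm{Sym}^d\simeq \mathrm{Sym}^d.$$ If $2$ is invertible in $k$, then $\mathrm{Sym}^d\,\underline{\otimes}\,\wedge^d\simeq\wedge^d$. If $2=0$ in $k$, then $\mathrm{Sym}^d\,\underline{\otimes}\,\wedge^d\simeq\mathrm{Sym}^d$. -/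

import Mathlib

open CategoryTheory CategoryTheory.Limits Opposite TensorProduct

universe u

noncomputable section

namespace StrictPolynomial

/-! ### Divided powers of modules -/

section Modules

variable (k : Type u) [CommRing k] (d : ℕ)

/-- The action of `σ ∈ S_d` on `V^{⊗ d}` by permuting the tensor factors. -/
def permAct (V : Type u) [AddCommGroup V] [Module k V] (σ : Equiv.Perm (Fin d)) :
    (⨂[k]^d V) ≃ₗ[k] (⨂[k]^d V) :=
  PiTensorProduct.reindex k (fun _ => V) σ

@[simp]
theorem permAct_tprod (V : Type u) [AddCommGroup V] [Module k V] (σ : Equiv.Perm (Fin d))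
    (v : Fin d → V) :
    permAct k d V σ (PiTensorProduct.tprod k v) = PiTensorProduct.tprod k (fun i => v (σ.symm i)) :=
  PiTensorProduct.reindex_tprod σ v

/-- The `d`-th divided power `Γ^d(V) = (V^{⊗ d})^{S_d}`. -/
def dividedPower (V : Type u) [AddCommGroup V] [Module k V] : Submodule k (⨂[k]^d V) where
  carrier := {x | ∀ σ : Equiv.Perm (Fin d), permAct k d V σ x = x}
  add_mem' hx hy σ := by rw [map_add, hx σ, hy σ]
  zero_mem' σ := map_zero _
  smul_mem' c x hx σ := by rw [map_smul, hx σ]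

variable {k d} {U V W U' V' W' : Type u}
  [AddCommGroup U] [Module k U] [AddCommGroup V] [Module k V] [AddCommGroup W] [Module k W]
  [AddCommGroup U'] [Module k U'] [AddCommGroup V'] [Module k V'] [AddCommGroup W'] [Module k W']

/-- Extend a bilinear map `U × V → W` factorwise to `U^{⊗ d} × V^{⊗ d} → W^{⊗ d}`. -/
def factorwise (B : U →ₗ[k] V →ₗ[k] W) : (⨂[k]^d U) →ₗ[k] (⨂[k]^d V) →ₗ[k] (⨂[k]^d W) :=
  PiTensorProduct.map₂ (fun _ => B)

@[simp]
theorem factorwise_tprod (B : U →ₗ[k] V →ₗ[k] W) (x : Fin d → U) (y : Fin d → V) :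
    factorwise B (PiTensorProduct.tprod k x) (PiTensorProduct.tprod k y) =
      PiTensorProduct.tprod k (fun i => B (x i) (y i)) :=
  PiTensorProduct.map₂_tprod_tprod _ x y

theorem tensor_induction {p : (⨂[k]^d V) → Prop} (x : ⨂[k]^d V)
    (h : ∀ v : Fin d → V, p (PiTensorProduct.tprod k v))
    (h_add : ∀ a b, p a → p b → p (a + b)) (h_smul : ∀ (c : k) a, p a → p (c • a)) : p x :=
  PiTensorProduct.induction_on x (fun c v => h_smul c _ (h v)) (fun a b => h_add a b)

theorem permAct_factorwise (B : U →ₗ[k] V →ₗ[k] W) (σ : Equiv.Perm (Fin d))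
    (x : ⨂[k]^d U) (y : ⨂[k]^d V) :
    permAct k d W σ (factorwise B x y) = factorwise B (permAct k d U σ x) (permAct k d V σ y) := by
  induction x using tensor_induction with
  | h_add a b ha hb => simp only [map_add, LinearMap.add_apply, ha, hb]
  | h_smul c a ha => simp only [map_smul, LinearMap.smul_apply, ha]
  | h u =>
    induction y using tensor_induction with
    | h_add a b ha hb => simp only [map_add, ha, hb]
    | h_smul c a ha => simp only [map_smul, ha]
    | h v => simp

/-- A bilinear map `U × V → W` induces `Γ^d(U) × Γ^d(V) → Γ^d(W)`. -/
def dividedPowerMap₂ (B : U →ₗ[k] V →ₗ[k] W) :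
    dividedPower k d U →ₗ[k] dividedPower k d V →ₗ[k] dividedPower k d W :=
  LinearMap.mk₂ k
    (fun x y => ⟨factorwise B x.1 y.1, fun σ => by
      rw [permAct_factorwise, x.2 σ, y.2 σ]⟩)
    (fun x x' y => by ext; simp) (fun c x y => by ext; simp)
    (fun x y y' => by ext; simp) (fun c x y => by ext; simp)

@[simp]
theorem dividedPowerMap₂_coe (B : U →ₗ[k] V →ₗ[k] W) (x : dividedPower k d U)
    (y : dividedPower k d V) : (dividedPowerMap₂ B x y : ⨂[k]^d W) = factorwise B x.1 y.1 := rfl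

/-- The element `u ⊗ ⋯ ⊗ u` of `Γ^d(U)`. -/
def dividedPowerDiag (u : U) : dividedPower k d U :=
  ⟨PiTensorProduct.tprod k (fun _ => u), fun σ => by simp⟩

@[simp]
theorem dividedPowerDiag_coe (u : U) :
    (dividedPowerDiag (k := k) (d := d) u : ⨂[k]^d U) = PiTensorProduct.tprod k (fun _ => u) := rfl

/-- The composition pairing `(g, f) ↦ g ∘ f`. -/
def compBilin : (V →ₗ[k] W) →ₗ[k] (U →ₗ[k] V) →ₗ[k] (U →ₗ[k] W) :=
  LinearMap.mk₂ k (fun g f => g ∘ₗ f) (fun g g' f => LinearMap.add_comp f g' g)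
    (fun c g f => LinearMap.smul_comp c g f) (fun g f f' => LinearMap.comp_add f f' g)
    (fun c g f => LinearMap.comp_smul g c f)

@[simp]
theorem compBilin_apply (g : V →ₗ[k] W) (f : U →ₗ[k] V) : compBilin g f = g ∘ₗ f := rfl

/-- The evaluation pairing `(f, v) ↦ f v`. -/
def evalBilin : (V →ₗ[k] W) →ₗ[k] V →ₗ[k] W := LinearMap.id

@[simp]
theorem evalBilin_apply (f : V →ₗ[k] W) (v : V) : evalBilin f v = f v := rfl

/-- The pairing `(f, g) ↦ f ⊗ g`. -/
def tensorBilin : (U →ₗ[k] U') →ₗ[k] (V →ₗ[k] V') →ₗ[k] (U ⊗[k] V →ₗ[k] U' ⊗[k] V') :=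
  TensorProduct.mapBilinear (RingHom.id k) U V U' V'

@[simp]
theorem tensorBilin_apply (f : U →ₗ[k] U') (g : V →ₗ[k] V') :
    tensorBilin f g = TensorProduct.map f g := rfl

theorem factorwise_id_comp (f : ⨂[k]^d (U →ₗ[k] V)) :
    factorwise compBilin (PiTensorProduct.tprod k (fun _ => (LinearMap.id : V →ₗ[k] V))) f = f := by
  induction f using tensor_induction with
  | h_add a b ha hb => simp only [map_add, ha, hb]
  | h_smul c a ha => simp only [map_smul, ha]
  | h v => simp

theorem factorwise_comp_id (f : ⨂[k]^d (U →ₗ[k] V)) :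
    factorwise compBilin f (PiTensorProduct.tprod k (fun _ => (LinearMap.id : U →ₗ[k] U))) = f := by
  induction f using tensor_induction with
  | h_add a b ha hb => simp only [map_add, LinearMap.add_apply, ha, hb]
  | h_smul c a ha => simp only [map_smul, LinearMap.smul_apply, ha]
  | h v => simp

theorem factorwise_comp_assoc {T : Type u} [AddCommGroup T] [Module k T]
    (h : ⨂[k]^d (V →ₗ[k] W)) (g : ⨂[k]^d (U →ₗ[k] V)) (f : ⨂[k]^d (T →ₗ[k] U)) :
    factorwise compBilin h (factorwise compBilin g f) =
      factorwise compBilin (factorwise compBilin h g) f := by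
  induction h using tensor_induction with
  | h_add a b ha hb => simp only [map_add, LinearMap.add_apply, ha, hb]
  | h_smul c a ha => simp only [map_smul, LinearMap.smul_apply, ha]
  | h h =>
    induction g using tensor_induction with
    | h_add a b ha hb => simp only [map_add, LinearMap.add_apply, ha, hb]
    | h_smul c a ha => simp only [map_smul, LinearMap.smul_apply, ha]
    | h g =>
      induction f using tensor_induction with
      | h_add a b ha hb => simp only [map_add, ha, hb]
      | h_smul c a ha => simp only [map_smul, ha]
      | h f => simp [LinearMap.comp_assoc]

theorem factorwise_id_eval (x : ⨂[k]^d V) :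
    factorwise evalBilin (PiTensorProduct.tprod k (fun _ => (LinearMap.id : V →ₗ[k] V))) x = x := by
  induction x using tensor_induction with
  | h_add a b ha hb => simp only [map_add, ha, hb]
  | h_smul c a ha => simp only [map_smul, ha]
  | h v => simp

theorem factorwise_comp_eval (g : ⨂[k]^d (V →ₗ[k] W)) (f : ⨂[k]^d (U →ₗ[k] V)) (x : ⨂[k]^d U) :
    factorwise evalBilin (factorwise compBilin g f) x =
      factorwise evalBilin g (factorwise evalBilin f x) := by
  induction g using tensor_induction with
  | h_add a b ha hb => simp only [map_add, LinearMap.add_apply, ha, hb]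
  | h_smul c a ha => simp only [map_smul, LinearMap.smul_apply, ha]
  | h g =>
    induction f using tensor_induction with
    | h_add a b ha hb => simp only [map_add, LinearMap.add_apply, ha, hb]
    | h_smul c a ha => simp only [map_smul, LinearMap.smul_apply, ha]
    | h f =>
      induction x using tensor_induction with
      | h_add a b ha hb => simp only [map_add, ha, hb]
      | h_smul c a ha => simp only [map_smul, ha]
      | h x => simp

theorem factorwise_tensor_comp
    (f' : ⨂[k]^d (U' →ₗ[k] W)) (f : ⨂[k]^d (U →ₗ[k] U'))
    (g' : ⨂[k]^d (V' →ₗ[k] W')) (g : ⨂[k]^d (V →ₗ[k] V')) :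
    factorwise tensorBilin (factorwise compBilin f' f) (factorwise compBilin g' g) =
      factorwise compBilin (factorwise tensorBilin f' g') (factorwise tensorBilin f g) := by
  induction f' using tensor_induction with
  | h_add a b ha hb => simp only [map_add, LinearMap.add_apply, ha, hb]
  | h_smul c a ha => simp only [map_smul, LinearMap.smul_apply, ha]
  | h f' =>
    induction f using tensor_induction with
    | h_add a b ha hb => simp only [map_add, LinearMap.add_apply, ha, hb]
    | h_smul c a ha => simp only [map_smul, LinearMap.smul_apply, ha]
    | h f =>
      induction g' using tensor_induction with
      | h_add a b ha hb => simp only [map_add, LinearMap.add_apply, ha, hb]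
      | h_smul c a ha => simp only [map_smul, LinearMap.smul_apply, ha]
      | h g' =>
        induction g using tensor_induction with
        | h_add a b ha hb => simp only [map_add, ha, hb]
        | h_smul c a ha => simp only [map_smul, ha]
        | h g => simp [TensorProduct.map_comp]

end Modules

/-! ### The divided power category -/

/-- The objects of `Γ^d P_k`: finitely generated projective `k`-modules. -/
structure DivPow (k : Type u) [CommRing k] (d : ℕ) : Type (u + 1) where
  carrier : Type u
  [addCommGroup : AddCommGroup carrier]
  [module : Module k carrier]
  [finite : Module.Finite k carrier]
  [projective : Module.Projective k carrier]

attribute [instance] DivPow.addCommGroup DivPow.module DivPow.finite DivPow.projective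

variable (k : Type u) [CommRing k] (d : ℕ)

namespace DivPow

variable {k d}

/-- The morphisms of `Γ^d P_k`: `Hom(V, W) = Γ^d (Hom_k(V, W))`. -/
def Hom (V W : DivPow k d) : Type u := dividedPower k d (V.carrier →ₗ[k] W.carrier)

instance (V W : DivPow k d) : AddCommGroup (Hom V W) :=
  inferInstanceAs (AddCommGroup (dividedPower k d (V.carrier →ₗ[k] W.carrier)))

instance (V W : DivPow k d) : Module k (Hom V W) :=
  inferInstanceAs (Module k (dividedPower k d (V.carrier →ₗ[k] W.carrier)))

/-- The category `Γ^d P_k`; composition is factorwise composition of linear maps. -/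
instance : Category (DivPow k d) where
  Hom V W := Hom V W
  id V := dividedPowerDiag (LinearMap.id : V.carrier →ₗ[k] V.carrier)
  comp f g := dividedPowerMap₂ compBilin g f
  id_comp f := Subtype.ext (factorwise_comp_id f.1)
  comp_id f := Subtype.ext (factorwise_id_comp f.1)
  assoc f g h := Subtype.ext (factorwise_comp_assoc h.1 g.1 f.1)

/-- The underlying invariant tensor of a morphism. -/
def tensor {V W : DivPow k d} (f : V ⟶ W) : ⨂[k]^d (V.carrier →ₗ[k] W.carrier) :=
  Subtype.val (p := fun x => x ∈ dividedPower k d (V.carrier →ₗ[k] W.carrier)) f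

/-- View an element of `Γ^d (Hom_k(V, W))` as a morphism. -/
def ofTensor {V W : DivPow k d} (f : dividedPower k d (V.carrier →ₗ[k] W.carrier)) : V ⟶ W := f

@[simp]
theorem tensor_ofTensor {V W : DivPow k d} (f : dividedPower k d (V.carrier →ₗ[k] W.carrier)) :
    tensor (ofTensor f) = f.1 := rfl

@[ext]
theorem hom_ext {V W : DivPow k d} {f g : V ⟶ W} (h : tensor f = tensor g) : f = g :=
  Subtype.ext h

theorem permAct_tensor {V W : DivPow k d} (f : V ⟶ W) (σ : Equiv.Perm (Fin d)) :
    permAct k d _ σ (tensor f) = tensor f :=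
  Subtype.property (p := fun x => x ∈ dividedPower k d (V.carrier →ₗ[k] W.carrier)) f σ

@[simp]
theorem tensor_id (V : DivPow k d) :
    tensor (𝟙 V) = PiTensorProduct.tprod k (fun _ => LinearMap.id) := rfl

@[simp]
theorem tensor_comp {U V W : DivPow k d} (f : U ⟶ V) (g : V ⟶ W) :
    tensor (f ≫ g) = factorwise compBilin (tensor g) (tensor f) := rfl

instance : Preadditive (DivPow k d) where
  homGroup V W := inferInstanceAs (AddCommGroup (Hom V W))
  add_comp _ _ _ f f' g := Subtype.ext (map_add (factorwise compBilin (tensor g)) (tensor f) (tensor f'))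
  comp_add _ _ _ f g g' :=
    Subtype.ext (LinearMap.map_add₂ (factorwise compBilin) (tensor g) (tensor g') (tensor f))

instance : Linear k (DivPow k d) where
  homModule V W := inferInstanceAs (Module k (Hom V W))
  smul_comp _ _ _ r f g := Subtype.ext (map_smul (factorwise compBilin (tensor g)) r (tensor f))
  comp_smul _ _ _ f r g :=
    Subtype.ext (LinearMap.map_smul₂ (factorwise compBilin) r (tensor g) (tensor f))

@[simp]
theorem tensor_add {V W : DivPow k d} (f g : V ⟶ W) : tensor (f + g) = tensor f + tensor g := rfl

@[simp]
theorem tensor_smul {V W : DivPow k d} (r : k) (f : V ⟶ W) : tensor (r • f) = r • tensor f := rfl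

/-- The tensor product of `Γ^d P_k` as a bifunctor: `V ⊗_k W` on objects, and the map
`Γ^d Hom(V, V') × Γ^d Hom(W, W') → Γ^d Hom(V ⊗ W, V' ⊗ W')` induced by `(f, g) ↦ f ⊗ g`. -/
def tensorFunctor : DivPow k d ⥤ DivPow k d ⥤ DivPow k d where
  obj V :=
    { obj := fun W => ⟨V.carrier ⊗[k] W.carrier⟩
      map := fun {W W'} g => ofTensor (V := ⟨V.carrier ⊗[k] W.carrier⟩)
        (W := ⟨V.carrier ⊗[k] W'.carrier⟩) (dividedPowerMap₂ tensorBilin (𝟙 V : Hom V V) g)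
      map_id := fun W => by
        ext
        change factorwise tensorBilin (tensor (𝟙 V)) (tensor (𝟙 W)) = _
        simp
      map_comp := fun {W W' W''} g g' => by
        ext
        change factorwise tensorBilin (tensor (𝟙 V)) (tensor (g ≫ g')) =
          factorwise compBilin (factorwise tensorBilin (tensor (𝟙 V)) (tensor g'))
            (factorwise tensorBilin (tensor (𝟙 V)) (tensor g))
        rw [← factorwise_tensor_comp, ← tensor_comp, ← tensor_comp, Category.comp_id] }
  map {V V'} f :=
    { app := fun W => ofTensor (V := ⟨V.carrier ⊗[k] W.carrier⟩)
        (W := ⟨V'.carrier ⊗[k] W.carrier⟩) (dividedPowerMap₂ tensorBilin (f : Hom V V') (𝟙 W : Hom W W))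
      naturality := fun {W W'} g => by
        ext
        change factorwise compBilin (factorwise tensorBilin (tensor f) (tensor (𝟙 W')))
            (factorwise tensorBilin (tensor (𝟙 V)) (tensor g)) =
          factorwise compBilin (factorwise tensorBilin (tensor (𝟙 V')) (tensor g))
            (factorwise tensorBilin (tensor f) (tensor (𝟙 W)))
        rw [← factorwise_tensor_comp, ← factorwise_tensor_comp, ← tensor_comp, ← tensor_comp,
          ← tensor_comp, ← tensor_comp]
        simp only [Category.comp_id, Category.id_comp] }
  map_id V := by
    ext W
    change factorwise tensorBilin (tensor (𝟙 V)) (tensor (𝟙 W)) = _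
    simp
  map_comp {V V' V''} f f' := by
    ext W
    change factorwise tensorBilin (tensor (f ≫ f')) (tensor (𝟙 W)) =
      factorwise compBilin (factorwise tensorBilin (tensor f') (tensor (𝟙 W)))
        (factorwise tensorBilin (tensor f) (tensor (𝟙 W)))
    rw [← factorwise_tensor_comp, ← tensor_comp, ← tensor_comp, Category.comp_id]

/-- Isomorphic modules are isomorphic in `Γ^d P_k`. -/
def isoOfEquiv {V W : DivPow k d} (e : V.carrier ≃ₗ[k] W.carrier) : V ≅ W where
  hom := ofTensor (dividedPowerDiag e.toLinearMap)
  inv := ofTensor (dividedPowerDiag e.symm.toLinearMap)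
  hom_inv_id := by ext; simp
  inv_hom_id := by ext; simp

/-- The category `Γ^d P_k` is essentially small. -/
instance essentiallySmall : EssentiallySmall.{u} (DivPow k d) := by
  rw [essentiallySmall_iff_objectPropertyEssentiallySmall_top]
  let I : Type u := Σ n : ℕ, {S : Submodule k (Fin n → k) // Module.Projective k ((Fin n → k) ⧸ S)}
  let g : I → DivPow k d := fun i =>
    haveI := i.2.2
    ⟨(Fin i.1 → k) ⧸ i.2.1⟩
  refine ⟨.ofObj g, inferInstance, fun V _ => ?_⟩
  obtain ⟨n, S, ⟨e⟩⟩ := Module.Finite.exists_fin_quot_equiv k V.carrier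
  have hS : Module.Projective k ((Fin n → k) ⧸ S) := Module.Projective.of_equiv e.symm
  exact ⟨_, ⟨(⟨n, S, hS⟩ : I)⟩, ⟨isoOfEquiv e.symm⟩⟩

end DivPow

/-! ### Strict polynomial functors -/

/-- A functor `Γ^d P_k ⥤ k`-Mod is `k`-linear if it is additive and `k`-linear on morphisms. -/
def isLinear : ObjectProperty (DivPow k d ⥤ ModuleCat.{u} k) :=
  fun F => F.Additive ∧ F.Linear k

/-- The category `Rep Γ^d_k` of strict polynomial functors of degree `d`: the `k`-linear functors
`Γ^d P_k ⥤ k`-Mod with all natural transformations. -/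
abbrev RepGamma : Type (u + 1) := (isLinear k d).FullSubcategory

instance isLinear_closedUnderColimits (J : Type*) [Category J]
    [HasColimitsOfShape J (ModuleCat.{u} k)] :
    (isLinear k d).IsClosedUnderColimitsOfShape J where
  colimitsOfShape_le := by
    rintro X ⟨p⟩
    have hc : ∀ V : DivPow k d, IsColimit (((evaluation _ _).obj V).mapCocone p.cocone) :=
      fun V => isColimitOfPreserves _ p.isColimit
    refine ⟨⟨fun {V W f g} => (hc V).hom_ext fun j => ?_⟩,
      ⟨fun {V W} f r => (hc V).hom_ext fun j => ?_⟩⟩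
    · have h := (p.prop_diag_obj j).1
      have e : ∀ q : V ⟶ W, (p.ι.app j).app V ≫ X.map q = (p.diag.obj j).map q ≫ (p.ι.app j).app W :=
        fun q => ((p.ι.app j).naturality q).symm
      change (p.ι.app j).app V ≫ X.map (f + g) = (p.ι.app j).app V ≫ (X.map f + X.map g)
      rw [Preadditive.comp_add, e, e, e, h.map_add, Preadditive.add_comp]
    · have h := (p.prop_diag_obj j).2
      have e : ∀ q : V ⟶ W, (p.ι.app j).app V ≫ X.map q = (p.diag.obj j).map q ≫ (p.ι.app j).app W :=
        fun q => ((p.ι.app j).naturality q).symm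
      change (p.ι.app j).app V ≫ X.map (r • f) = (p.ι.app j).app V ≫ (r • X.map f)
      rw [Linear.comp_smul, e, e, h.map_smul, Linear.smul_comp]

/-- The functor `V ↦ Γ^{d,V} = Hom(V, -)`, contravariant in `V`. -/
def representable : (DivPow k d)ᵒᵖ ⥤ RepGamma k d :=
  (isLinear k d).lift (linearCoyoneda k (DivPow k d)) fun V =>
    ⟨inferInstance, ⟨fun f r => by
      ext g
      exact Linear.comp_smul _ _ _ g r f⟩⟩

variable {k d}

/-- The category of morphisms `Γ^{d,V} → X`, with `V` ranging over `Γ^d P_k`. -/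
abbrev RepresentablesOver (X : RepGamma k d) : Type (u + 1) :=
  CostructuredArrow (representable k d) X

instance : LocallySmall.{u} (RepGamma k d) :=
  locallySmall_of_faithful
    ((isLinear k d).ι ⋙ (Functor.whiskeringLeft _ _ _).obj (equivSmallModel.{u} (DivPow k d)).inverse)

instance (X : RepGamma k d) : HasColimitsOfShape (RepresentablesOver X) (ModuleCat.{u} k) :=
  HasColimitsOfShape.of_essentiallySmall.{u, u} _ _

instance (X : RepGamma k d) : HasColimitsOfShape (RepresentablesOver X) (RepGamma k d) :=
  inferInstance

/-- The diagram `(Γ^{d,V} → X) ↦ ((Γ^{d,W} → Y) ↦ Γ^{d, V ⊗ W})`. -/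
def internalTensorDiagram (X Y : RepGamma k d) :
    RepresentablesOver X ⥤ RepresentablesOver Y ⥤ RepGamma k d :=
  CostructuredArrow.proj (representable k d) X ⋙ DivPow.tensorFunctor.op ⋙ Functor.opHom _ _ ⋙
    (Functor.whiskeringLeft _ _ _).obj (CostructuredArrow.proj (representable k d) Y) ⋙
      (Functor.whiskeringRight _ _ _).obj (representable k d)

theorem internalTensorDiagram_obj_obj (X Y : RepGamma k d) (p : RepresentablesOver X)
    (q : RepresentablesOver Y) :
    ((internalTensorDiagram X Y).obj p).obj q =
      (representable k d).obj (op ⟨p.left.unop.carrier ⊗[k] q.left.unop.carrier⟩) := rfl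

/-- The internal tensor product
`X ⊗ Y = colim_{Γ^{d,V} → X} colim_{Γ^{d,W} → Y} Γ^{d, V ⊗ W}`. -/
def internalTensor (X Y : RepGamma k d) : RepGamma k d :=
  colimit (internalTensorDiagram X Y ⋙ colim)

/-! ### Symmetric and exterior powers -/

section Powers

variable {V W : Type u} [AddCommGroup V] [Module k V] [AddCommGroup W] [Module k W]

variable (k d V) in
/-- The submodule of `V^{⊗ d}` spanned by all `σ x - x`. -/
def symRelations : Submodule k (⨂[k]^d V) :=
  Submodule.span k {y | ∃ (σ : Equiv.Perm (Fin d)) (x : ⨂[k]^d V), y = permAct k d V σ x - x}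

variable (k d V) in
/-- The symmetric power `Sym^d(V)`, as the coinvariants `(V^{⊗ d})_{S_d}`. -/
abbrev SymPower : Type u := (⨂[k]^d V) ⧸ symRelations k d V

/-- The map `V^{⊗ d} → W^{⊗ d}` induced by an element of `Hom_k(V, W)^{⊗ d}`. -/
def tensorPowerMap : (⨂[k]^d (V →ₗ[k] W)) →ₗ[k] (⨂[k]^d V) →ₗ[k] (⨂[k]^d W) :=
  factorwise evalBilin

theorem permAct_tensorPowerMap {f : ⨂[k]^d (V →ₗ[k] W)}
    (hf : f ∈ dividedPower k d (V →ₗ[k] W)) (σ : Equiv.Perm (Fin d)) (x : ⨂[k]^d V) :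
    permAct k d W σ (tensorPowerMap f x) = tensorPowerMap f (permAct k d V σ x) := by
  rw [tensorPowerMap, permAct_factorwise, hf σ]

/-- The map `Sym^d(V) → Sym^d(W)` induced by an element of `Γ^d(Hom_k(V, W))`. -/
def symMap (f : ⨂[k]^d (V →ₗ[k] W)) (hf : f ∈ dividedPower k d (V →ₗ[k] W)) :
    SymPower k d V →ₗ[k] SymPower k d W :=
  Submodule.mapQ _ _ (tensorPowerMap f) (by
    rw [symRelations, Submodule.span_le]
    rintro _ ⟨σ, x, rfl⟩
    refine Submodule.subset_span ⟨σ, tensorPowerMap f x, ?_⟩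
    rw [map_sub, permAct_tensorPowerMap hf])

@[simp]
theorem symMap_mk (f : ⨂[k]^d (V →ₗ[k] W)) (hf : f ∈ dividedPower k d (V →ₗ[k] W))
    (x : ⨂[k]^d V) : symMap f hf (Submodule.Quotient.mk x) =
      Submodule.Quotient.mk (tensorPowerMap f x) := rfl

variable (k d V) in
/-- The projection `V^{⊗ d} → ∧^d(V)`, `v₁ ⊗ ⋯ ⊗ v_d ↦ v₁ ∧ ⋯ ∧ v_d`. -/
def wedgeProj : (⨂[k]^d V) →ₗ[k] ⋀[k]^d V :=
  PiTensorProduct.lift (exteriorPower.ιMulti k d (M := V)).toMultilinearMap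

@[simp]
theorem wedgeProj_tprod (v : Fin d → V) :
    wedgeProj k d V (PiTensorProduct.tprod k v) = exteriorPower.ιMulti k d v := by
  simp [wedgeProj]

theorem wedgeProj_surjective : Function.Surjective (wedgeProj k d V) := by
  rw [← LinearMap.range_eq_top, ← top_le_iff, ← exteriorPower.ιMulti_span, Submodule.span_le]
  rintro _ ⟨v, rfl⟩
  exact ⟨PiTensorProduct.tprod k v, wedgeProj_tprod v⟩

theorem toTensorPower_wedgeProj (x : ⨂[k]^d V) :
    exteriorPower.toTensorPower k V d (wedgeProj k d V x) =
      ∑ σ : Equiv.Perm (Fin d), ((Equiv.Perm.sign σ : ℤ) : k) • permAct k d V σ x := by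
  induction x using tensor_induction with
  | h_add a b ha hb => simp only [map_add, ha, hb, smul_add, Finset.sum_add_distrib]
  | h_smul c a ha =>
    simp only [map_smul, ha, Finset.smul_sum]
    exact Finset.sum_congr rfl fun σ _ => smul_comm _ _ _
  | h v =>
    rw [wedgeProj_tprod, exteriorPower.toTensorPower_apply_ιMulti]
    refine Fintype.sum_equiv (Equiv.inv _) _ _ fun σ => ?_
    rw [Equiv.inv_apply, Equiv.Perm.sign_inv, permAct_tprod, Int.cast_smul_eq_zsmul]
    rfl

theorem toTensorPower_map (f : V →ₗ[k] W) (x : ⋀[k]^d V) :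
    exteriorPower.toTensorPower k W d (exteriorPower.map d f x) =
      PiTensorProduct.map (fun _ => f) (exteriorPower.toTensorPower k V d x) := by
  have : exteriorPower.toTensorPower k W d ∘ₗ exteriorPower.map d f =
      PiTensorProduct.map (fun _ => f) ∘ₗ exteriorPower.toTensorPower k V d := by
    apply exteriorPower.linearMap_ext
    ext v
    simp [Units.smul_def]
  exact LinearMap.congr_fun this x

theorem toTensorPower_injective_of_free {I : Type*} [LinearOrder I] (b : Module.Basis I k V) :
    Function.Injective (exteriorPower.toTensorPower k V d) := by
  rw [injective_iff_map_eq_zero]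
  intro x hx
  have h : ∀ f : Fin d → Module.Dual k V,
      exteriorPower.pairingDual k V d (exteriorPower.ιMulti k d f) x = 0 := by
    intro f
    rw [exteriorPower.pairingDual, exteriorPower.alternatingMapLinearEquiv_apply_ιMulti]
    change TensorPower.multilinearMapToDual k V d f (exteriorPower.toTensorPower k V d x) = 0
    rw [hx, map_zero]
  apply (b.exteriorPower d).repr.injective
  ext s
  rw [exteriorPower.basis_repr_apply, map_zero]
  exact h _

/-- For projective `V`, antisymmetrization embeds `∧^d(V)` in `V^{⊗ d}`. -/
theorem toTensorPower_injective [Module.Finite k V] [Module.Projective k V] :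
    Function.Injective (exteriorPower.toTensorPower k V d) := by
  obtain ⟨n, p, s, -, -, hps⟩ := Module.Finite.exists_comp_eq_id_of_projective k V
  rw [injective_iff_map_eq_zero]
  intro x hx
  apply exteriorPower.map_injective p hps
  apply toTensorPower_injective_of_free (Pi.basisFun k (Fin n))
  rw [toTensorPower_map, hx, map_zero, map_zero, map_zero]

theorem toTensorPower_comp {f : ⨂[k]^d (V →ₗ[k] W)} (hf : f ∈ dividedPower k d (V →ₗ[k] W))
    (x : ⨂[k]^d V) :
    exteriorPower.toTensorPower k W d (wedgeProj k d W (tensorPowerMap f x)) =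
      tensorPowerMap f (exteriorPower.toTensorPower k V d (wedgeProj k d V x)) := by
  simp only [toTensorPower_wedgeProj, permAct_tensorPowerMap hf, map_sum, map_smul]

theorem wedgeMap_ext {g g' : (⋀[k]^d V) →ₗ[k] ⋀[k]^d W}
    (h : ∀ x, g (wedgeProj k d V x) = g' (wedgeProj k d V x)) : g = g' := by
  refine LinearMap.ext fun y => ?_
  obtain ⟨x, rfl⟩ := wedgeProj_surjective y
  exact h x

variable [Module.Finite k W] [Module.Projective k W]

/-- The map `∧^d(V) → ∧^d(W)` induced by an element of `Γ^d(Hom_k(V, W))`: the unique map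
compatible with the projections `V^{⊗ d} → ∧^d(V)` and `W^{⊗ d} → ∧^d(W)`. -/
def wedgeMap (f : ⨂[k]^d (V →ₗ[k] W)) (hf : f ∈ dividedPower k d (V →ₗ[k] W)) :
    (⋀[k]^d V) →ₗ[k] ⋀[k]^d W :=
  exteriorPower.alternatingMapLinearEquiv
    { (wedgeProj k d W ∘ₗ tensorPowerMap f).compMultilinearMap (PiTensorProduct.tprod k) with
      map_eq_zero_of_eq' := fun v i j hv hij => by
        apply toTensorPower_injective
        change exteriorPower.toTensorPower k W d
          (wedgeProj k d W (tensorPowerMap f (PiTensorProduct.tprod k v))) = _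
        rw [toTensorPower_comp hf, wedgeProj_tprod, AlternatingMap.map_eq_zero_of_eq _ v hv hij]
        simp only [map_zero] }

@[simp]
theorem wedgeMap_wedgeProj (f : ⨂[k]^d (V →ₗ[k] W)) (hf : f ∈ dividedPower k d (V →ₗ[k] W))
    (x : ⨂[k]^d V) :
    wedgeMap f hf (wedgeProj k d V x) = wedgeProj k d W (tensorPowerMap f x) := by
  induction x using tensor_induction with
  | h_add a b ha hb => simp only [map_add, ha, hb]
  | h_smul c a ha => simp only [map_smul, ha]
  | h v =>
    rw [wedgeProj_tprod, wedgeMap, exteriorPower.alternatingMapLinearEquiv_apply_ιMulti]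
    rfl

end Powers

namespace DivPow

theorem tensor_mem {V W : DivPow k d} (f : V ⟶ W) :
    tensor f ∈ dividedPower k d (V.carrier →ₗ[k] W.carrier) :=
  fun σ => permAct_tensor f σ

theorem tensorPowerMap_id (V : DivPow k d) (x : ⨂[k]^d V.carrier) :
    tensorPowerMap (tensor (𝟙 V)) x = x :=
  factorwise_id_eval x

theorem tensorPowerMap_comp {U V W : DivPow k d} (f : U ⟶ V) (g : V ⟶ W) (x : ⨂[k]^d U.carrier) :
    tensorPowerMap (tensor (f ≫ g)) x = tensorPowerMap (tensor g) (tensorPowerMap (tensor f) x) :=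
  factorwise_comp_eval (tensor g) (tensor f) x

/-- The action of a morphism of `Γ^d P_k` on symmetric powers. -/
def symAction {V W : DivPow k d} (f : V ⟶ W) :
    SymPower k d V.carrier →ₗ[k] SymPower k d W.carrier :=
  symMap (tensor f) (tensor_mem f)

@[simp]
theorem symAction_mk {V W : DivPow k d} (f : V ⟶ W) (x : ⨂[k]^d V.carrier) :
    symAction f (Submodule.Quotient.mk x) =
      Submodule.Quotient.mk (tensorPowerMap (tensor f) x) := rfl

theorem symAction_ext {V W : DivPow k d} {g g' : SymPower k d V.carrier →ₗ[k] SymPower k d W.carrier}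
    (h : ∀ x, g (Submodule.Quotient.mk x) = g' (Submodule.Quotient.mk x)) : g = g' := by
  refine LinearMap.ext fun y => ?_
  obtain ⟨x, rfl⟩ := Submodule.Quotient.mk_surjective _ y
  exact h x

theorem symAction_id (V : DivPow k d) : symAction (𝟙 V) = LinearMap.id :=
  symAction_ext fun x => by rw [symAction_mk, tensorPowerMap_id, LinearMap.id_apply]

theorem symAction_comp {U V W : DivPow k d} (f : U ⟶ V) (g : V ⟶ W) :
    symAction (f ≫ g) = symAction g ∘ₗ symAction f :=
  symAction_ext fun x => by
    rw [LinearMap.comp_apply, symAction_mk, symAction_mk, symAction_mk, tensorPowerMap_comp]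

theorem symAction_add {V W : DivPow k d} (f g : V ⟶ W) :
    symAction (f + g) = symAction f + symAction g :=
  symAction_ext fun x => by
    rw [LinearMap.add_apply, symAction_mk, symAction_mk, symAction_mk, tensor_add, map_add,
      LinearMap.add_apply, Submodule.Quotient.mk_add]

theorem symAction_smul {V W : DivPow k d} (r : k) (f : V ⟶ W) :
    symAction (r • f) = r • symAction f :=
  symAction_ext fun x => by
    rw [LinearMap.smul_apply, symAction_mk, symAction_mk, tensor_smul, map_smul,
      LinearMap.smul_apply, Submodule.Quotient.mk_smul]

/-- The action of a morphism of `Γ^d P_k` on exterior powers. -/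
def wedgeAction {V W : DivPow k d} (f : V ⟶ W) : (⋀[k]^d V.carrier) →ₗ[k] ⋀[k]^d W.carrier :=
  wedgeMap (tensor f) (tensor_mem f)

@[simp]
theorem wedgeAction_wedgeProj {V W : DivPow k d} (f : V ⟶ W) (x : ⨂[k]^d V.carrier) :
    wedgeAction f (wedgeProj k d V.carrier x) =
      wedgeProj k d W.carrier (tensorPowerMap (tensor f) x) :=
  wedgeMap_wedgeProj _ _ x

theorem wedgeAction_id (V : DivPow k d) : wedgeAction (𝟙 V) = LinearMap.id :=
  wedgeMap_ext fun x => by rw [wedgeAction_wedgeProj, tensorPowerMap_id, LinearMap.id_apply]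

theorem wedgeAction_comp {U V W : DivPow k d} (f : U ⟶ V) (g : V ⟶ W) :
    wedgeAction (f ≫ g) = wedgeAction g ∘ₗ wedgeAction f :=
  wedgeMap_ext fun x => by
    rw [LinearMap.comp_apply, wedgeAction_wedgeProj, wedgeAction_wedgeProj, wedgeAction_wedgeProj,
      tensorPowerMap_comp]

theorem wedgeAction_add {V W : DivPow k d} (f g : V ⟶ W) :
    wedgeAction (f + g) = wedgeAction f + wedgeAction g :=
  wedgeMap_ext fun x => by
    rw [LinearMap.add_apply, wedgeAction_wedgeProj, wedgeAction_wedgeProj, wedgeAction_wedgeProj,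
      tensor_add, map_add, LinearMap.add_apply, map_add]

theorem wedgeAction_smul {V W : DivPow k d} (r : k) (f : V ⟶ W) :
    wedgeAction (r • f) = r • wedgeAction f :=
  wedgeMap_ext fun x => by
    rw [LinearMap.smul_apply, wedgeAction_wedgeProj, wedgeAction_wedgeProj,
      tensor_smul, map_smul, LinearMap.smul_apply, map_smul]

end DivPow

variable (k d)

/-- The strict polynomial functor `Sym^d`. -/
def sym : RepGamma k d where
  obj :=
    { obj := fun V => ModuleCat.of k (SymPower k d V.carrier)
      map := fun f => ModuleCat.ofHom (DivPow.symAction f)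
      map_id := fun V => ModuleCat.hom_ext (DivPow.symAction_id V)
      map_comp := fun f g => ModuleCat.hom_ext (DivPow.symAction_comp f g) }
  property :=
    ⟨⟨fun {_ _ f g} => ModuleCat.hom_ext (DivPow.symAction_add f g)⟩,
      ⟨fun f r => ModuleCat.hom_ext (DivPow.symAction_smul r f)⟩⟩

/-- The strict polynomial functor `∧^d`. -/
def wedge : RepGamma k d where
  obj :=
    { obj := fun V => ModuleCat.of k (⋀[k]^d V.carrier)
      map := fun f => ModuleCat.ofHom (DivPow.wedgeAction f)
      map_id := fun V => ModuleCat.hom_ext (DivPow.wedgeAction_id V)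
      map_comp := fun f g => ModuleCat.hom_ext (DivPow.wedgeAction_comp f g) }
  property :=
    ⟨⟨fun {_ _ f g} => ModuleCat.hom_ext (DivPow.wedgeAction_add f g)⟩,
      ⟨fun f r => ModuleCat.hom_ext (DivPow.wedgeAction_smul r f)⟩⟩

end StrictPolynomial

end

/-! By the Yoneda lemma, a cocone over the diagram defining `internalTensor X Y` with vertex `Z` is
the same thing as a family of maps X(V) × Y(W) → Z(V ⊗ W) natural in V and W. So X ⊗ Y carries the
universal natural pairing (`internalTensorPairing_isUniversal`), and it suffices to exhibit a
universal pairing with values in Sym^d or ∧^d.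

Sym^d and ∧^d are quotients of V ↦ V^{⊗ d}, and each is generated by the class of e_1 ⊗ ⋯ ⊗ e_d over
k^d. Indeed a tensor x = v_1 ⊗ ⋯ ⊗ v_d gives a morphism `classify V x` from k^d to V, the
symmetrization of the tensor of the maps e ↦ e_i v_i, and this morphism carries e_1 ⊗ ⋯ ⊗ e_d to x
(`symCoord_basisTensor`). A natural pairing z is therefore determined by its value z₀ in Z(k^d ⊗
k^d) on the two generators.

The decisive identity is `tensorHom_classify`: the tensor product of the morphisms of x and y is the
sum over ρ in S_d of the morphisms of x ⊗ ρy, each precomposed with 1 ⊗ P_ρ (P_ρ the permutation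
matrix) and with the diagonal map δ : k^d ⊗ k^d → k^d, e_i ⊗ e_j ↦ δ_{ij} e_i. Hence z depends only
on ζ = Z(δ) z₀ in Z(k^d). If S_d acts on X and Y through characters χ and ψ, then ζ is equivariant
for χψ, and z(x, y) is the sum over ρ of ψ(ρ⁻¹) times the image of ζ under the morphism of x ⊗ ρy.
This singles out the universal pairing, `pairingAux`, with values in a quotient S of the tensor
power functor whose relations are forced by χψ-equivariance (`pairing_isUniversal`).

With χψ trivial, S is Sym^d. With χψ the sign, S is ∧^d when 2 is invertible, and Sym^d when 2 = 0,
since the sign is then trivial. The relations of ∧^d beyond sign-equivariance are respected over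
every k, because antisymmetrization factors through ∧^d (`sum_signChar_permAct`). -/

noncomputable section

namespace StrictPolynomial

/-! ### Interleaving tensors and morphisms out of `k^d` -/

section TensorPowers

variable {k : Type u} [CommRing k] {d : ℕ} {V W V' W' : Type u}
  [AddCommGroup V] [Module k V] [AddCommGroup W] [Module k W]
  [AddCommGroup V'] [Module k V'] [AddCommGroup W'] [Module k W']

theorem permAct_permAct (σ τ : Equiv.Perm (Fin d)) (x : ⨂[k]^d V) :
    permAct k d V σ (permAct k d V τ x) = permAct k d V (σ * τ) x := by
  induction x using tensor_induction with
  | h_add a b ha hb => simp only [map_add, ha, hb]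
  | h_smul c a ha => simp only [map_smul, ha]
  | h v => simp [Equiv.Perm.mul_def]

theorem permAct_one (x : ⨂[k]^d V) : permAct k d V 1 x = x := by
  induction x using tensor_induction with
  | h_add a b ha hb => simp only [map_add, ha, hb]
  | h_smul c a ha => simp only [map_smul, ha]
  | h v => rw [permAct_tprod]; rfl

variable (k d V W) in
/-- The map `V^{⊗ d} × W^{⊗ d} → (V ⊗ W)^{⊗ d}` tensoring factor by factor. -/
def interleave : (⨂[k]^d V) →ₗ[k] (⨂[k]^d W) →ₗ[k] (⨂[k]^d (V ⊗[k] W)) :=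
  factorwise (TensorProduct.mk k V W)

theorem permAct_interleave (σ : Equiv.Perm (Fin d)) (x : ⨂[k]^d V) (y : ⨂[k]^d W) :
    permAct k d _ σ (interleave k d V W x y) =
      interleave k d V W (permAct k d V σ x) (permAct k d W σ y) :=
  permAct_factorwise _ σ x y

theorem tensorPowerMap_interleave (f : ⨂[k]^d (V →ₗ[k] V')) (g : ⨂[k]^d (W →ₗ[k] W'))
    (x : ⨂[k]^d V) (y : ⨂[k]^d W) :
    tensorPowerMap (factorwise tensorBilin f g) (interleave k d V W x y) =
      interleave k d V' W' (tensorPowerMap f x) (tensorPowerMap g y) := by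
  unfold tensorPowerMap interleave
  induction f using tensor_induction with
  | h_add a b ha hb => simp only [map_add, LinearMap.add_apply, ha, hb]
  | h_smul c a ha => simp only [map_smul, LinearMap.smul_apply, ha]
  | h f =>
    induction g using tensor_induction with
    | h_add a b ha hb => simp only [map_add, LinearMap.add_apply, ha, hb]
    | h_smul c a ha => simp only [map_smul, LinearMap.smul_apply, ha]
    | h g =>
      induction x using tensor_induction with
      | h_add a b ha hb => simp only [map_add, LinearMap.add_apply, ha, hb]
      | h_smul c a ha => simp only [map_smul, LinearMap.smul_apply, ha]
      | h x =>
        induction y using tensor_induction with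
        | h_add a b ha hb => simp only [map_add, ha, hb]
        | h_smul c a ha => simp only [map_smul, ha]
        | h y => simp

/-! ### Tensors in V^{⊗ d} as morphisms k^d → V -/

variable (k V) in
/-- The map `V → Hom_k(k^d, V)` sending `v` to `e ↦ e_i v`. -/
def coordHom (i : Fin d) : V →ₗ[k] ((Fin d → k) →ₗ[k] V) :=
  LinearMap.mk₂ k (fun v e => e i • v) (fun _ _ _ => smul_add _ _ _)
    (fun _ _ _ => smul_comm _ _ _) (fun _ _ _ => add_smul _ _ _) (fun _ _ _ => mul_smul _ _ _)

@[simp]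
theorem coordHom_apply (i : Fin d) (v : V) (e : Fin d → k) : coordHom k V i v e = e i • v := rfl

variable (k d V) in
/-- Apply `coordHom` for `i` to the `i`-th tensor factor. -/
def coordTensor : (⨂[k]^d V) →ₗ[k] (⨂[k]^d ((Fin d → k) →ₗ[k] V)) :=
  PiTensorProduct.map (fun i => coordHom k V i)

@[simp]
theorem coordTensor_tprod (v : Fin d → V) :
    coordTensor k d V (PiTensorProduct.tprod k v) =
      PiTensorProduct.tprod k (fun i => coordHom k V i (v i)) :=
  PiTensorProduct.map_tprod _ _

variable (k d V) in
/-- The symmetrization of `coordTensor`, with values in `Γ^d(Hom_k(k^d, V))`. -/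
def symCoord : (⨂[k]^d V) →ₗ[k] dividedPower k d ((Fin d → k) →ₗ[k] V) :=
  LinearMap.codRestrict _
    (∑ σ : Equiv.Perm (Fin d), (permAct k d _ σ).toLinearMap ∘ₗ coordTensor k d V) (by
      intro x τ
      simp only [LinearMap.sum_apply, LinearMap.comp_apply, LinearEquiv.coe_coe, map_sum,
        permAct_permAct]
      exact Fintype.sum_equiv (Equiv.mulLeft τ) _ _ fun σ => rfl)

theorem symCoord_coe (x : ⨂[k]^d V) :
    (symCoord k d V x : ⨂[k]^d ((Fin d → k) →ₗ[k] V)) =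
      ∑ σ : Equiv.Perm (Fin d), permAct k d _ σ (coordTensor k d V x) := by
  change (∑ σ : Equiv.Perm (Fin d), (permAct k d _ σ).toLinearMap ∘ₗ coordTensor k d V) x = _
  simp only [LinearMap.sum_apply, LinearMap.comp_apply, LinearEquiv.coe_coe]

variable (k d) in
/-- The tensor `e_1 ⊗ ⋯ ⊗ e_d` of the standard basis vectors of `k^d`. -/
def basisTensor : ⨂[k]^d (Fin d → k) :=
  PiTensorProduct.tprod k (fun i => Pi.single i 1)

/-- If σ moves some i, the i-th factor is scaled by an off-diagonal coordinate of a basis vector,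
which is zero. -/
theorem tprod_coord_basis (σ : Equiv.Perm (Fin d)) (v : Fin d → V) :
    PiTensorProduct.tprod k (fun i => (Pi.single i (1 : k) : Fin d → k) (σ i) • v i) =
      if σ = 1 then PiTensorProduct.tprod k v else 0 := by
  split_ifs with h
  · subst h
    congr 1; ext i : 1
    change (Pi.single i (1 : k) : Fin d → k) i • v i = v i
    rw [Pi.single_eq_same, one_smul]
  · obtain ⟨i, hi⟩ : ∃ i, σ i ≠ i := by
      by_contra! h'
      exact h (Equiv.ext h')
    exact (PiTensorProduct.tprod k).map_coord_zero i (by simp [hi])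

/-- Evaluating the σ-summand pairs basis vectors with coordinates shifted by σ, so only σ = 1
survives. This makes e_1 ⊗ ⋯ ⊗ e_d a generator of the tensor power functor. -/
theorem symCoord_basisTensor (x : ⨂[k]^d V) :
    tensorPowerMap (symCoord k d V x : ⨂[k]^d ((Fin d → k) →ₗ[k] V)) (basisTensor k d) = x := by
  rw [symCoord_coe]
  induction x using tensor_induction with
  | h_add a b ha hb =>
    simp only [map_add, Finset.sum_add_distrib, LinearMap.add_apply, ha, hb]
  | h_smul c a ha => simp only [map_smul, ← Finset.smul_sum, LinearMap.smul_apply, ha]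
  | h v =>
    simp only [map_sum, LinearMap.sum_apply, coordTensor_tprod, permAct_tprod, tensorPowerMap,
      basisTensor, factorwise_tprod, evalBilin_apply, coordHom_apply]
    rw [Finset.sum_eq_single 1]
    · rw [tprod_coord_basis (1 : Equiv.Perm (Fin d)).symm]
      exact if_pos rfl
    · intro σ _ hσ
      rw [tprod_coord_basis σ.symm, if_neg]
      exact fun h => hσ (inv_eq_one.mp h)
    · simp

theorem comp_coordTensor (f : ⨂[k]^d (V →ₗ[k] W)) (x : ⨂[k]^d V) :
    factorwise compBilin f (coordTensor k d V x) = coordTensor k d W (tensorPowerMap f x) := by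
  unfold tensorPowerMap
  induction f using tensor_induction with
  | h_add a b ha hb => simp only [map_add, LinearMap.add_apply, ha, hb]
  | h_smul c a ha => simp only [map_smul, LinearMap.smul_apply, ha]
  | h f =>
    induction x using tensor_induction with
    | h_add a b ha hb => simp only [map_add, ha, hb]
    | h_smul c a ha => simp only [map_smul, ha]
    | h x =>
      simp only [coordTensor_tprod, factorwise_tprod, compBilin_apply, evalBilin_apply]
      congr 1; ext i : 1
      exact LinearMap.ext fun e => map_smul (f i) _ _

/-- Postcomposition does not touch the coordinates on k^d, and the invariance of `f` lets it pass
through each permutation in the symmetrization. -/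
theorem comp_symCoord (f : ⨂[k]^d (V →ₗ[k] W)) (hf : f ∈ dividedPower k d (V →ₗ[k] W))
    (x : ⨂[k]^d V) :
    factorwise compBilin f (symCoord k d V x : ⨂[k]^d ((Fin d → k) →ₗ[k] V)) =
      symCoord k d W (tensorPowerMap f x) := by
  simp only [symCoord_coe, map_sum]
  refine Finset.sum_congr rfl fun σ _ => ?_
  rw [← comp_coordTensor, permAct_factorwise, hf σ]

/-! ### Permutation matrices and the diagonal map -/

variable (k) in
/-- The permutation matrix sending `e_i` to `e_{τ i}`. -/
def permMatrixMap (τ : Equiv.Perm (Fin d)) : (Fin d → k) →ₗ[k] (Fin d → k) :=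
  LinearMap.funLeft k k τ.symm

@[simp]
theorem permMatrixMap_apply (τ : Equiv.Perm (Fin d)) (e : Fin d → k) (i : Fin d) :
    permMatrixMap k τ e i = e (τ.symm i) := rfl

/-- The inverse comes from the convention that `permAct` by σ puts the factor of index σ⁻¹ i in
position i, whereas here position i receives e_{τ i}. -/
theorem permMatrixMap_basisTensor (τ : Equiv.Perm (Fin d)) :
    tensorPowerMap (PiTensorProduct.tprod k fun _ => permMatrixMap k τ) (basisTensor k d) =
      permAct k d _ τ⁻¹ (basisTensor k d) := by
  simp only [tensorPowerMap, basisTensor, factorwise_tprod, permAct_tprod, evalBilin_apply]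
  congr 1; ext i : 1; ext j
  simp only [permMatrixMap_apply, Pi.single_apply, Equiv.symm_apply_eq]
  rfl

/-- Permuting the factors of `x` changes which factor meets which coordinate. Up to a permutation of
all factors, absorbed by the symmetrization, this is a relabelling of the coordinates of k^d. -/
theorem symCoord_permAct (τ : Equiv.Perm (Fin d)) (x : ⨂[k]^d V) :
    (symCoord k d V (permAct k d V τ x) : ⨂[k]^d ((Fin d → k) →ₗ[k] V)) =
      factorwise compBilin (symCoord k d V x).1
        (PiTensorProduct.tprod k fun _ => permMatrixMap k τ⁻¹) := by
  have h : permAct k d _ τ⁻¹ (coordTensor k d V (permAct k d V τ x)) =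
      factorwise compBilin (coordTensor k d V x)
        (PiTensorProduct.tprod k fun _ => permMatrixMap k τ⁻¹) := by
    induction x using tensor_induction with
    | h_add a b ha hb => simp only [map_add, LinearMap.add_apply, ha, hb]
    | h_smul c a ha => simp only [map_smul, LinearMap.smul_apply, ha]
    | h v =>
      simp only [coordTensor_tprod, permAct_tprod, factorwise_tprod, compBilin_apply]
      congr 1; ext i : 1; apply LinearMap.ext; intro e
      change e (τ i) • v (τ.symm (τ i)) = e (τ i) • v i
      rw [Equiv.symm_apply_apply]
  have h' (σ : Equiv.Perm (Fin d)) : permAct k d _ σ (PiTensorProduct.tprod k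
      fun _ => permMatrixMap k τ⁻¹) = PiTensorProduct.tprod k fun _ => permMatrixMap k τ⁻¹ := by
    simp
  rw [symCoord_coe, symCoord_coe, map_sum, LinearMap.sum_apply]
  refine Fintype.sum_equiv (Equiv.mulRight τ) _ _ fun σ => ?_
  rw [Equiv.coe_mulRight, ← h' (σ * τ), ← permAct_factorwise, ← h, permAct_permAct, mul_assoc,
    mul_inv_cancel, mul_one]

variable (k d) in
/-- The map `k^d ⊗ k^d → k^d` sending `e_i ⊗ e_j` to `δ_{ij} e_i`. -/
def diagMap : (Fin d → k) ⊗[k] (Fin d → k) →ₗ[k] (Fin d → k) :=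
  TensorProduct.lift (LinearMap.mul k (Fin d → k))

@[simp]
theorem diagMap_tmul (e e' : Fin d → k) : diagMap k d (e ⊗ₜ e') = e * e' := rfl

theorem permMatrixMap_comp_diagMap (τ : Equiv.Perm (Fin d)) :
    permMatrixMap k τ ∘ₗ diagMap k d =
      diagMap k d ∘ₗ TensorProduct.map (permMatrixMap k τ) (permMatrixMap k τ) := by
  apply TensorProduct.ext'
  intro e e'
  ext i
  simp

/-- The i-th factor becomes the coordinatewise product of e_i with e_{ρ⁻¹ i}, which vanishes as soon
as ρ moves i. -/
theorem diagMap_interleave_basisTensor (ρ : Equiv.Perm (Fin d)) :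
    tensorPowerMap (PiTensorProduct.tprod k fun _ => diagMap k d)
        (interleave k d _ _ (basisTensor k d) (permAct k d _ ρ (basisTensor k d))) =
      if ρ = 1 then basisTensor k d else 0 := by
  simp only [tensorPowerMap, basisTensor, interleave, permAct_tprod, factorwise_tprod,
    evalBilin_apply, TensorProduct.mk_apply, diagMap_tmul]
  split_ifs with h
  · subst h
    congr 1; ext i : 1
    change (Pi.single i (1 : k) * Pi.single i 1 : Fin d → k) = _
    rw [← Pi.single_mul, mul_one]
  · obtain ⟨i, hi⟩ : ∃ i, ρ.symm i ≠ i := by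
      by_contra! h'
      exact h (inv_eq_one.mp (Equiv.ext h'))
    refine (PiTensorProduct.tprod k).map_coord_zero i ?_
    ext j
    rcases eq_or_ne j i with rfl | hj
    · simp [hi.symm]
    · simp [Pi.single_apply, hj]

/-- On pure tensors the i-th factor of both sides sends e ⊗ e' to e_i e'_{ρ⁻¹ i} times x_i ⊗ y_{ρ⁻¹
i}: two scalar coordinates multiply into a single one, which is where the diagonal map comes from.
-/
theorem tensor_coordTensor (ρ : Equiv.Perm (Fin d)) (x : ⨂[k]^d V) (y : ⨂[k]^d W) :
    factorwise tensorBilin (coordTensor k d V x) (permAct k d _ ρ (coordTensor k d W y)) =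
      factorwise compBilin (coordTensor k d _ (interleave k d V W x (permAct k d W ρ y)))
        (PiTensorProduct.tprod k fun _ =>
          diagMap k d ∘ₗ TensorProduct.map LinearMap.id (permMatrixMap k ρ)) := by
  unfold interleave
  induction x using tensor_induction with
  | h_add a b ha hb => simp only [map_add, LinearMap.add_apply, ha, hb]
  | h_smul c a ha => simp only [map_smul, LinearMap.smul_apply, ha]
  | h x =>
    induction y using tensor_induction with
    | h_add a b ha hb => simp only [map_add, LinearMap.add_apply, ha, hb]
    | h_smul c a ha => simp only [map_smul, LinearMap.smul_apply, ha]
    | h y =>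
      simp only [coordTensor_tprod, permAct_tprod, factorwise_tprod, compBilin_apply,
        tensorBilin_apply]
      congr 1; ext i : 1
      apply TensorProduct.ext'
      intro e e'
      simp [TensorProduct.smul_tmul', TensorProduct.tmul_smul, smul_smul, mul_comm]

/-- The tensor product of `symCoord x` and `symCoord y` as a sum of maps factoring through the
diagonal map `k^d ⊗ k^d → k^d`. -/
theorem tensor_symCoord (x : ⨂[k]^d V) (y : ⨂[k]^d W) :
    factorwise tensorBilin (symCoord k d V x).1 (symCoord k d W y).1 =
      ∑ ρ : Equiv.Perm (Fin d),
        factorwise compBilin (symCoord k d _ (interleave k d V W x (permAct k d W ρ y))).1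
          (PiTensorProduct.tprod k fun _ =>
            diagMap k d ∘ₗ TensorProduct.map LinearMap.id (permMatrixMap k ρ)) := by
  have h (σ ρ : Equiv.Perm (Fin d)) :
      permAct k d _ σ (PiTensorProduct.tprod k fun _ =>
        diagMap k d ∘ₗ TensorProduct.map LinearMap.id (permMatrixMap k ρ)) =
      PiTensorProduct.tprod k fun _ =>
        diagMap k d ∘ₗ TensorProduct.map LinearMap.id (permMatrixMap k ρ) := by
    simp
  simp only [symCoord_coe, map_sum, LinearMap.sum_apply]
  refine Finset.sum_comm.trans (Eq.trans ?_ Finset.sum_comm)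
  refine Finset.sum_congr rfl fun σ _ => ?_
  -- The two symmetrizations give a double sum. Writing the second permutation as σρ, the common σ
  -- can be pulled out, and it fixes the tensor power of a single map by `h`.
  refine (Fintype.sum_equiv (Equiv.mulLeft σ) _ _ fun ρ => ?_).symm
  rw [Equiv.coe_mulLeft, ← h σ ρ, ← permAct_factorwise, ← tensor_coordTensor,
    permAct_factorwise, permAct_permAct]

end TensorPowers

/-! ### Iterated colimits -/

section IteratedColimit

universe v v₁ v₂ w w₁ w₂

variable {J : Type w₁} [Category.{v₁} J] {K : Type w₂} [Category.{v₂} K] {C : Type w}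
  [Category.{v} C] [HasColimitsOfShape J C] [HasColimitsOfShape K C] (D : J ⥤ K ⥤ C) {Z : C}

/-- The structure maps of an iterated colimit. -/
def iteratedColimitι (p : J) (q : K) : (D.obj p).obj q ⟶ colimit (D ⋙ colim) :=
  colimit.ι (D.obj p) q ≫ colimit.ι (D ⋙ colim) p

theorem map_iteratedColimitι_left {p p' : J} (a : p ⟶ p') (q : K) :
    (D.map a).app q ≫ iteratedColimitι D p' q = iteratedColimitι D p q := by
  have h := colimit.w (D ⋙ colim) a
  rw [iteratedColimitι, iteratedColimitι, ← h]
  exact (ι_colimMap_assoc (D.map a) q _).symm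

theorem map_iteratedColimitι_right (p : J) {q q' : K} (b : q ⟶ q') :
    (D.obj p).map b ≫ iteratedColimitι D p q' = iteratedColimitι D p q :=
  colimit.w_assoc (D.obj p) b _

variable {D}

theorem iteratedColimit_hom_ext {m n : colimit (D ⋙ colim) ⟶ Z}
    (h : ∀ p q, iteratedColimitι D p q ≫ m = iteratedColimitι D p q ≫ n) : m = n :=
  colimit.hom_ext fun p => colimit.hom_ext fun q =>
    (Category.assoc _ _ _).symm.trans ((h p q).trans (Category.assoc _ _ _))

theorem exists_iteratedColimit_desc (c : ∀ p q, (D.obj p).obj q ⟶ Z)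
    (left : ∀ {p p'} (a : p ⟶ p') q, (D.map a).app q ≫ c p' q = c p q)
    (right : ∀ p {q q'} (b : q ⟶ q'), (D.obj p).map b ≫ c p q' = c p q) :
    ∃ m : colimit (D ⋙ colim) ⟶ Z, ∀ p q, iteratedColimitι D p q ≫ m = c p q := by
  let c' (p : J) : Cocone (D.obj p) :=
    { pt := Z
      ι := { app := c p, naturality := fun _ _ b => (right p b).trans (Category.comp_id _).symm } }
  let c'' : Cocone (D ⋙ colim) :=
    { pt := Z
      ι :=
        { app := fun p => colimit.desc _ (c' p)
          naturality := fun p p' a => by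
            refine Eq.trans (colimit.hom_ext fun q => ?_) (Category.comp_id _).symm
            refine (ι_colimMap_assoc (D.map a) q _).trans ?_
            refine Eq.trans ?_ (colimit.ι_desc (c' p) q).symm
            refine Eq.trans ?_ (left a q)
            exact congrArg _ (colimit.ι_desc (c' p') q) } }
  refine ⟨colimit.desc _ c'', fun p q => ?_⟩
  refine (Category.assoc _ _ _).trans ?_
  refine (congrArg _ (colimit.ι_desc c'' p)).trans ?_
  exact colimit.ι_desc (c' p) q

end IteratedColimit

/-! ### The universal property of the internal tensor product -/

section UniversalProperty

variable {k : Type u} [CommRing k] {d : ℕ}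

namespace RepGamma

/-- The action of a morphism of `Γ^d P_k` on a strict polynomial functor. -/
def act (Z : RepGamma k d) {V W : DivPow k d} (f : V ⟶ W) : Z.obj.obj V →ₗ[k] Z.obj.obj W :=
  (Z.obj.map f).hom

variable (X Y Z : RepGamma k d) {U V W : DivPow k d}

theorem act_id (x : Z.obj.obj V) : Z.act (𝟙 V) x = x := by
  simp [act]

theorem act_comp (f : U ⟶ V) (g : V ⟶ W) (x : Z.obj.obj U) :
    Z.act (f ≫ g) x = Z.act g (Z.act f x) := by
  simp [act]

theorem act_add (f g : V ⟶ W) : Z.act (f + g) = Z.act f + Z.act g := by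
  have := Z.property.1
  simp [act, Functor.map_add]

theorem act_smul (r : k) (f : V ⟶ W) : Z.act (r • f) = r • Z.act f := by
  have := Z.property.2
  simp [act, Functor.map_smul]

/-- The action as a linear map on morphisms. -/
def actₗ : (V ⟶ W) →ₗ[k] (Z.obj.obj V →ₗ[k] Z.obj.obj W) where
  toFun f := Z.act f
  map_add' := Z.act_add
  map_smul' := Z.act_smul

theorem act_sum {ι : Type*} (s : Finset ι) (f : ι → (V ⟶ W)) (x : Z.obj.obj V) :
    Z.act (∑ i ∈ s, f i) x = ∑ i ∈ s, Z.act (f i) x :=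
  map_sum (Z.actₗ.flip x) f s

variable {X Y Z}

/-- The component at `V` of a morphism of strict polynomial functors. -/
def comp (m : X ⟶ Y) (V : DivPow k d) : X.obj.obj V →ₗ[k] Y.obj.obj V :=
  (m.hom.app V).hom

theorem comp_act (m : X ⟶ Y) (f : V ⟶ W) (x : X.obj.obj V) :
    comp m W (X.act f x) = Y.act f (comp m V x) :=
  LinearMap.congr_fun (congrArg ModuleCat.Hom.hom (m.hom.naturality f)) x

theorem hom_ext_comp {m n : X ⟶ Y} (h : ∀ V x, comp m V x = comp n V x) : m = n := by
  apply ObjectProperty.hom_ext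
  ext V x
  exact h V x

/-- Construct a morphism of strict polynomial functors from its components. -/
def mkHom (m : ∀ V, X.obj.obj V →ₗ[k] Y.obj.obj V)
    (h : ∀ {V W : DivPow k d} (f : V ⟶ W) x, m W (X.act f x) = Y.act f (m V x)) : X ⟶ Y :=
  ObjectProperty.homMk
    { app := fun V => ModuleCat.ofHom (m V)
      naturality := fun _ _ f => ModuleCat.hom_ext (LinearMap.ext (h f)) }

/-! ### The Yoneda lemma -/

/-- The element of `X(V)` corresponding to a morphism `Γ^{d,V} → X`. -/
def element (α : (representable k d).obj (op V) ⟶ X) : X.obj.obj V :=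
  comp α V (𝟙 V)

/-- The morphism `Γ^{d,V} → X` corresponding to an element of `X(V)`. -/
def ofElement (x : X.obj.obj V) : (representable k d).obj (op V) ⟶ X :=
  mkHom (fun W => (X.actₗ.flip x : (V ⟶ W) →ₗ[k] X.obj.obj W))
    (fun f g => X.act_comp g f x)

theorem element_ofElement (x : X.obj.obj V) : element (ofElement x) = x :=
  X.act_id x

/-- Naturality of `α` applied to f = f ∘ 1: the image of the identity determines `α`. -/
theorem comp_eq_act_element (α : (representable k d).obj (op V) ⟶ X) (f : V ⟶ W) :
    comp α W f = X.act f (element α) :=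
  (congrArg (comp α W) (Category.id_comp f).symm).trans (comp_act α f (𝟙 V))

theorem element_ext {α β : (representable k d).obj (op V) ⟶ X} (h : element α = element β) :
    α = β :=
  hom_ext_comp fun W f => by
    exact (comp_eq_act_element α f).trans ((congrArg _ h).trans (comp_eq_act_element β f).symm)

theorem ofElement_element (α : (representable k d).obj (op V) ⟶ X) : ofElement (element α) = α :=
  element_ext (element_ofElement _)

theorem element_map_comp (f : V ⟶ W) (α : (representable k d).obj (op V) ⟶ X) :
    element ((representable k d).map f.op ≫ α) = X.act f (element α) :=
  (congrArg (comp α W) (Category.comp_id f)).trans (comp_eq_act_element α f)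

end RepGamma

open RepGamma

namespace DivPow

/-- The tensor product of two objects of `Γ^d P_k`. -/
abbrev tensorObj (V W : DivPow k d) : DivPow k d := ⟨V.carrier ⊗[k] W.carrier⟩

/-- The tensor product of two morphisms of `Γ^d P_k`. -/
def tensorHom {V V' W W' : DivPow k d} (f : V ⟶ V') (g : W ⟶ W') :
    tensorObj V W ⟶ tensorObj V' W' :=
  ofTensor (V := tensorObj V W) (W := tensorObj V' W')
    (dividedPowerMap₂ tensorBilin (f : Hom V V') (g : Hom W W'))

@[simp]
theorem tensor_tensorHom {V V' W W' : DivPow k d} (f : V ⟶ V') (g : W ⟶ W') :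
    tensor (tensorHom f g) = factorwise tensorBilin (tensor f) (tensor g) := rfl

/-- The iterated colimit only provides relations in one variable at a time, hence this
factorization. -/
theorem tensorHom_eq {V V' W W' : DivPow k d} (f : V ⟶ V') (g : W ⟶ W') :
    tensorHom f g = tensorHom f (𝟙 W) ≫ tensorHom (𝟙 V') g := by
  ext
  rw [tensor_comp, tensor_tensorHom, tensor_tensorHom, tensor_tensorHom, ← factorwise_tensor_comp,
    ← tensor_comp, ← tensor_comp, Category.comp_id, Category.id_comp]

end DivPow

/-! ### Natural pairings and their universality -/

/-- A family of maps `X(V) × Y(W) → Z(V ⊗ W)` natural in `V` and `W`. -/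
@[ext]
structure NaturalPairing (X Y Z : RepGamma k d) where
  toFun : ∀ {V W : DivPow k d}, X.obj.obj V → Y.obj.obj W → Z.obj.obj (DivPow.tensorObj V W)
  natural : ∀ {V V' W W' : DivPow k d} (f : V ⟶ V') (g : W ⟶ W') (x : X.obj.obj V)
    (y : Y.obj.obj W), toFun (X.act f x) (Y.act g y) = Z.act (DivPow.tensorHom f g) (toFun x y)

namespace NaturalPairing

variable {X Y Z Z' : RepGamma k d}

/-- Compose a pairing with a morphism of its target. -/
def postcomp (φ : NaturalPairing X Y Z) (m : Z ⟶ Z') : NaturalPairing X Y Z' where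
  toFun x y := RepGamma.comp m _ (φ.toFun x y)
  natural f g x y := by rw [φ.natural, comp_act]

@[simp]
theorem postcomp_toFun (φ : NaturalPairing X Y Z) (m : Z ⟶ Z') {V W : DivPow k d}
    (x : X.obj.obj V) (y : Y.obj.obj W) :
    (φ.postcomp m).toFun x y = RepGamma.comp m _ (φ.toFun x y) := rfl

/-- Bilinearity is not part of the definition of a pairing. Homogeneity nevertheless follows from
naturality along multiples of identities, since the functors are `k`-linear. -/
theorem map_smul (φ : NaturalPairing X Y Z) (r s : k) {V W : DivPow k d}
    (x : X.obj.obj V) (y : Y.obj.obj W) :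
    φ.toFun (r • x) (s • y) = (r * s) • φ.toFun x y := by
  have h : DivPow.tensorHom (r • 𝟙 V) (s • 𝟙 W) = (r * s) • 𝟙 (DivPow.tensorObj V W) := by
    ext
    simp [smul_smul, mul_comm]
  have := φ.natural (r • 𝟙 V) (s • 𝟙 W) x y
  rwa [h, act_smul, act_smul, act_smul, LinearMap.smul_apply, LinearMap.smul_apply,
    LinearMap.smul_apply, act_id, act_id, act_id] at this

/-- A pairing is universal if every pairing factors uniquely through it. -/
def IsUniversal (φ : NaturalPairing X Y Z) : Prop :=
  ∀ (Z' : RepGamma k d) (z : NaturalPairing X Y Z'), ∃! m : Z ⟶ Z', φ.postcomp m = z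

theorem IsUniversal.hom_ext {φ : NaturalPairing X Y Z} (h : φ.IsUniversal) {m n : Z ⟶ Z'}
    (e : φ.postcomp m = φ.postcomp n) : m = n :=
  (h Z' _).unique e rfl

theorem IsUniversal.nonempty_iso {φ : NaturalPairing X Y Z} (h : φ.IsUniversal)
    {φ' : NaturalPairing X Y Z'} (h' : φ'.IsUniversal) : Nonempty (Z ≅ Z') := by
  obtain ⟨m, hm, -⟩ := h Z' φ'
  obtain ⟨n, hn, -⟩ := h' Z φ
  refine ⟨⟨m, n, h.hom_ext ?_, h'.hom_ext ?_⟩⟩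
  · change (φ.postcomp m).postcomp n = φ
    rw [hm, hn]
  · change (φ'.postcomp n).postcomp m = φ'
    rw [hn, hm]

end NaturalPairing

variable (X Y : RepGamma k d)

/-- The structure map `Γ^{d, V ⊗ W} → X ⊗ Y`. -/
def internalTensorι (p : RepresentablesOver X) (q : RepresentablesOver Y) :
    (representable k d).obj (op (DivPow.tensorObj p.left.unop q.left.unop)) ⟶ internalTensor X Y :=
  iteratedColimitι (internalTensorDiagram X Y) p q

theorem map_internalTensorι_left {p p' : RepresentablesOver X} (a : p ⟶ p')
    (q : RepresentablesOver Y) :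
    (representable k d).map (DivPow.tensorHom a.left.unop (𝟙 q.left.unop)).op ≫
      internalTensorι X Y p' q = internalTensorι X Y p q :=
  map_iteratedColimitι_left (internalTensorDiagram X Y) a q

theorem map_internalTensorι_right (p : RepresentablesOver X) {q q' : RepresentablesOver Y}
    (b : q ⟶ q') :
    (representable k d).map (DivPow.tensorHom (𝟙 p.left.unop) b.left.unop).op ≫
      internalTensorι X Y p q' = internalTensorι X Y p q :=
  map_iteratedColimitι_right (internalTensorDiagram X Y) p b

variable {X Y}

/-- The object `Γ^{d,V} → X` of `RepresentablesOver X` given by an element of `X(V)`. -/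
abbrev overElement {V : DivPow k d} (x : X.obj.obj V) : RepresentablesOver X :=
  CostructuredArrow.mk (ofElement x)

/-- The morphism of `RepresentablesOver X` given by a morphism of `Γ^d P_k`. -/
def overElementMap {V V' : DivPow k d} (f : V ⟶ V') (x : X.obj.obj V) :
    overElement (X.act f x) ⟶ overElement x :=
  CostructuredArrow.homMk f.op (element_ext
    ((element_map_comp f (ofElement x)).trans
      ((congrArg (X.act f) (element_ofElement x)).trans (element_ofElement _).symm)))

variable (X Y) in
/-- The canonical pairing with values in the internal tensor product. -/
def internalTensorPairing : NaturalPairing X Y (internalTensor X Y) where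
  toFun x y := element (internalTensorι X Y (overElement x) (overElement y))
  natural {V V' W W'} f g x y := by
    rw [DivPow.tensorHom_eq, act_comp]
    refine Eq.trans ?_ (congrArg _ (element_map_comp (DivPow.tensorHom f (𝟙 W)) _))
    refine Eq.trans ?_ (element_map_comp (DivPow.tensorHom (𝟙 V') g) _)
    refine congrArg element ?_
    have h₁ := map_internalTensorι_left X Y (overElementMap f x) (overElement y)
    have h₂ := map_internalTensorι_right X Y (overElement (X.act f x)) (overElementMap g y)
    exact h₂.symm.trans (congrArg _ h₁.symm)

theorem exists_eq_overElement (p : RepresentablesOver X) :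
    ∃ (V : DivPow k d) (x : X.obj.obj V), p = overElement x := by
  obtain ⟨V, ⟨⟨⟩⟩, α⟩ := p
  exact ⟨V.unop, element α, congrArg CostructuredArrow.mk (ofElement_element α).symm⟩

/-- The commuting triangle of a morphism over `X`, evaluated at the identity. -/
theorem act_left_element {p p' : RepresentablesOver X} (a : p ⟶ p') :
    X.act a.left.unop (element (V := p'.left.unop) p'.hom) = element (V := p.left.unop) p.hom :=
  (element_map_comp a.left.unop p'.hom).symm.trans (congrArg element (CostructuredArrow.w a))

theorem internalTensor_hom_ext {Z : RepGamma k d} {m n : internalTensor X Y ⟶ Z}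
    (h : ∀ p q, internalTensorι X Y p q ≫ m = internalTensorι X Y p q ≫ n) : m = n :=
  iteratedColimit_hom_ext h

/-- Through Yoneda, the cocone conditions in the two variables are the naturality of `z` along f ⊗ 1
and 1 ⊗ g. -/
theorem exists_internalTensor_desc {Z : RepGamma k d} (z : NaturalPairing X Y Z) :
    ∃ m : internalTensor X Y ⟶ Z, ∀ p q, internalTensorι X Y p q ≫ m =
      ofElement (V := DivPow.tensorObj p.left.unop q.left.unop)
        (z.toFun (V := p.left.unop) (W := q.left.unop) (element p.hom) (element q.hom)) := by
  refine exists_iteratedColimit_desc (D := internalTensorDiagram X Y) _ ?_ ?_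
  · intro p p' a q
    refine element_ext (V := DivPow.tensorObj p.left.unop q.left.unop) ?_
    refine (element_map_comp (DivPow.tensorHom a.left.unop (𝟙 q.left.unop)) _).trans ?_
    rw [element_ofElement, element_ofElement, ← z.natural, act_left_element, act_id]
  · intro p q q' b
    refine element_ext (V := DivPow.tensorObj p.left.unop q.left.unop) ?_
    refine (element_map_comp (DivPow.tensorHom (𝟙 p.left.unop) b.left.unop) _).trans ?_
    rw [element_ofElement, element_ofElement, ← z.natural, act_left_element, act_id]

theorem internalTensorPairing_isUniversal : (internalTensorPairing X Y).IsUniversal := by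
  intro Z z
  obtain ⟨m, hm⟩ := exists_internalTensor_desc z
  -- By Yoneda, a morphism out of the colimit and the pairing it induces carry the same data on each
  -- structure map. This gives both existence and uniqueness.
  have key {V W : DivPow k d} (x : X.obj.obj V) (y : Y.obj.obj W) (n : internalTensor X Y ⟶ Z) :
      internalTensorι X Y (overElement x) (overElement y) ≫ n =
        ofElement (V := DivPow.tensorObj V W)
          (((internalTensorPairing X Y).postcomp n).toFun x y) :=
    (ofElement_element _).symm
  have hm' {V W : DivPow k d} (x : X.obj.obj V) (y : Y.obj.obj W) :
      internalTensorι X Y (overElement x) (overElement y) ≫ m =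
        ofElement (V := DivPow.tensorObj V W) (z.toFun x y) := by
    refine (hm _ _).trans (congrArg ofElement ?_)
    exact congrArg₂ z.toFun (element_ofElement x) (element_ofElement y)
  refine ⟨m, ?_, ?_⟩
  · ext V W x y
    refine (element_ofElement _).symm.trans (Eq.trans ?_ (element_ofElement _))
    exact congrArg element ((key x y m).symm.trans (hm' x y))
  · rintro n rfl
    refine internalTensor_hom_ext fun p q => ?_
    obtain ⟨V, x, rfl⟩ := exists_eq_overElement p
    obtain ⟨W, y, rfl⟩ := exists_eq_overElement q
    exact (key x y n).trans (hm' x y).symm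

end UniversalProperty

/-! ### Quotients of the tensor power functor -/

section Quotients

open RepGamma DivPow

variable {k : Type u} [CommRing k] {d : ℕ}

/-- A presentation of a strict polynomial functor as a quotient of `V ↦ V^{⊗ d}`. -/
structure TensorQuotient (X : RepGamma k d) where
  proj : ∀ V : DivPow k d, (⨂[k]^d V.carrier) →ₗ[k] X.obj.obj V
  surjective : ∀ V, Function.Surjective (proj V)
  natural : ∀ {V W : DivPow k d} (f : V ⟶ W) (x : ⨂[k]^d V.carrier),
    proj W (tensorPowerMap (tensor f) x) = X.act f (proj V x)

variable (k d) in
/-- The object `k^d` of `Γ^d P_k`. -/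
abbrev stdObj : DivPow k d := ⟨Fin d → k⟩

/-- The morphism `k^d → V` of `Γ^d P_k` associated with a tensor in `V^{⊗ d}`. -/
def classify (V : DivPow k d) : (⨂[k]^d V.carrier) →ₗ[k] (stdObj k d ⟶ V) :=
  symCoord k d V.carrier

theorem tensor_classify {V : DivPow k d} (x : ⨂[k]^d V.carrier) :
    tensor (classify V x) = (symCoord k d V.carrier x).1 := rfl

theorem classify_comp {V W : DivPow k d} (x : ⨂[k]^d V.carrier) (f : V ⟶ W) :
    classify V x ≫ f = classify W (tensorPowerMap (tensor f) x) := by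
  ext
  rw [tensor_comp, tensor_classify, tensor_classify, comp_symCoord _ (tensor_mem f)]

theorem tensor_sum {ι : Type*} (s : Finset ι) {V W : DivPow k d} (f : ι → (V ⟶ W)) :
    tensor (∑ i ∈ s, f i) = ∑ i ∈ s, tensor (f i) :=
  map_sum (AddMonoidHom.mk' (tensor (V := V) (W := W)) tensor_add) f s

/-- The morphism `f ⊗ ⋯ ⊗ f` of `Γ^d P_k`. -/
def diagHom {V W : DivPow k d} (f : V.carrier →ₗ[k] W.carrier) : V ⟶ W :=
  ofTensor (dividedPowerDiag f)

@[simp]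
theorem tensor_diagHom {V W : DivPow k d} (f : V.carrier →ₗ[k] W.carrier) :
    tensor (diagHom f) = PiTensorProduct.tprod k fun _ => f := rfl

theorem classify_permAct {V : DivPow k d} (τ : Equiv.Perm (Fin d)) (x : ⨂[k]^d V.carrier) :
    classify V (permAct k d _ τ x) =
      diagHom (V := stdObj k d) (W := stdObj k d) (permMatrixMap k τ⁻¹) ≫ classify V x := by
  ext
  rw [tensor_comp, tensor_classify, tensor_classify, symCoord_permAct]
  rfl

variable (k d) in
/-- The morphism `k^d ⊗ k^d → k^d` of `Γ^d P_k` sending `e_i ⊗ e_j` to `δ_{ij} e_i`. -/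
def diagonal : tensorObj (stdObj k d) (stdObj k d) ⟶ stdObj k d :=
  diagHom (V := tensorObj (stdObj k d) (stdObj k d)) (W := stdObj k d) (diagMap k d)

/-- The automorphism of `k^d` in `Γ^d P_k` given by a permutation matrix. -/
def permHom (τ : Equiv.Perm (Fin d)) : stdObj k d ⟶ stdObj k d :=
  diagHom (V := stdObj k d) (W := stdObj k d) (permMatrixMap k τ)

theorem diagonal_permHom (τ : Equiv.Perm (Fin d)) :
    diagonal k d ≫ permHom τ = tensorHom (permHom τ) (permHom τ) ≫ diagonal k d := by
  ext
  simp [diagonal, permHom, permMatrixMap_comp_diagMap]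

/-- This reduces a value in Z(k^d ⊗ k^d) to one in Z(k^d): after `classify` only the image under the
diagonal matters. -/
theorem tensorHom_classify {V W : DivPow k d} (x : ⨂[k]^d V.carrier) (y : ⨂[k]^d W.carrier) :
    tensorHom (classify V x) (classify W y) =
      ∑ ρ : Equiv.Perm (Fin d), tensorHom (𝟙 (stdObj k d)) (permHom ρ) ≫ diagonal k d ≫
          classify (tensorObj V W) (interleave k d _ _ x (permAct k d _ ρ y)) := by
  ext
  rw [tensor_tensorHom, tensor_classify, tensor_classify, tensor_symCoord, tensor_sum]
  refine Finset.sum_congr rfl fun ρ _ => ?_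
  rw [← Category.assoc, tensor_comp, tensor_classify]
  congr 1
  simp [diagonal, permHom]

namespace TensorQuotient

variable {X Y S Z : RepGamma k d} (qX : TensorQuotient X) (qY : TensorQuotient Y)
  (qS : TensorQuotient S)

/-- The generator of a quotient of the tensor power functor. -/
def generator : X.obj.obj (stdObj k d) :=
  qX.proj (stdObj k d) (basisTensor k d)

theorem act_classify_generator {V : DivPow k d} (x : ⨂[k]^d V.carrier) :
    X.act (classify V x) qX.generator = qX.proj V x := by
  rw [generator, ← qX.natural]
  exact congrArg _ (symCoord_basisTensor x)

/-- The symmetric group acts on the quotient through `χ`. -/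
def ActsBy (χ : Equiv.Perm (Fin d) → k) : Prop :=
  ∀ (V : DivPow k d) (σ : Equiv.Perm (Fin d)) (x : ⨂[k]^d V.carrier),
    qX.proj V (permAct k d _ σ x) = χ σ • qX.proj V x

variable {qX qY qS} {χ ψ : Equiv.Perm (Fin d) → k}

/-- A permutation matrix acts on e_1 ⊗ ⋯ ⊗ e_d by permuting its factors, so the character can be
read off on the generator. -/
theorem ActsBy.act_permHom (h : qX.ActsBy χ) (τ : Equiv.Perm (Fin d)) :
    X.act (permHom τ) qX.generator = χ τ⁻¹ • qX.generator := by
  rw [generator, ← qX.natural, ← h]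
  exact congrArg _ (permMatrixMap_basisTensor τ)

variable (qS ψ) in
/-- The pairing `(x, y) ↦ ∑ ψ(ρ⁻¹) [x ⊗ ρ y]` on tensor powers. -/
def pairingAux (V W : DivPow k d) : (⨂[k]^d V.carrier) →ₗ[k] (⨂[k]^d W.carrier) →ₗ[k]
    S.obj.obj (tensorObj V W) :=
  ∑ ρ : Equiv.Perm (Fin d), ψ ρ⁻¹ •
    ((interleave k d V.carrier W.carrier).compr₂ (qS.proj (tensorObj V W))).compl₂
      (permAct k d W.carrier ρ).toLinearMap

theorem pairingAux_apply {V W : DivPow k d} (x : ⨂[k]^d V.carrier) (y : ⨂[k]^d W.carrier) :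
    qS.pairingAux ψ V W x y = ∑ ρ : Equiv.Perm (Fin d), ψ ρ⁻¹ •
      qS.proj (tensorObj V W) (interleave k d V.carrier W.carrier x (permAct k d _ ρ y)) := by
  simp [pairingAux, LinearMap.sum_apply]

theorem pairingAux_natural {V V' W W' : DivPow k d} (f : V ⟶ V') (g : W ⟶ W')
    (x : ⨂[k]^d V.carrier) (y : ⨂[k]^d W.carrier) :
    qS.pairingAux ψ V' W' (tensorPowerMap (tensor f) x) (tensorPowerMap (tensor g) y) =
      S.act (tensorHom f g) (qS.pairingAux ψ V W x y) := by
  rw [pairingAux_apply, pairingAux_apply, map_sum]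
  refine Finset.sum_congr rfl fun ρ _ => ?_
  rw [map_smul, ← qS.natural, tensor_tensorHom, tensorPowerMap_interleave,
    permAct_tensorPowerMap (tensor_mem g)]

theorem pairingAux_congr (left : ∀ V W x y, qX.proj V x = 0 → qS.pairingAux ψ V W x y = 0)
    (right : ∀ V W x y, qY.proj W y = 0 → qS.pairingAux ψ V W x y = 0) {V W : DivPow k d}
    {x x' : ⨂[k]^d V.carrier} {y y' : ⨂[k]^d W.carrier} (hx : qX.proj V x = qX.proj V x')
    (hy : qY.proj W y = qY.proj W y') :
    qS.pairingAux ψ V W x y = qS.pairingAux ψ V W x' y' := by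
  have h₁ := left V W (x - x') y (by rw [map_sub, hx, sub_self])
  have h₂ := right V W x' (y - y') (by rw [map_sub, hy, sub_self])
  rw [map_sub, LinearMap.sub_apply, sub_eq_zero] at h₁
  rw [map_sub, sub_eq_zero] at h₂
  exact h₁.trans h₂

variable (qX qY qS ψ) in
/-- The pairing `X(V) × Y(W) → S(V ⊗ W)` induced by `pairingAux`. -/
def pairing (left : ∀ V W x y, qX.proj V x = 0 → qS.pairingAux ψ V W x y = 0)
    (right : ∀ V W x y, qY.proj W y = 0 → qS.pairingAux ψ V W x y = 0) :
    NaturalPairing X Y S where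
  -- The lifts to tensors are arbitrary; `left` and `right` make the value independent of them.
  toFun {V W} x y := qS.pairingAux ψ V W (Function.surjInv (qX.surjective V) x)
    (Function.surjInv (qY.surjective W) y)
  natural {V V' W W'} f g x y := by
    rw [← pairingAux_natural]
    refine pairingAux_congr left right ?_ ?_
    · rw [qX.natural, Function.surjInv_eq (qX.surjective _), Function.surjInv_eq (qX.surjective _)]
    · rw [qY.natural, Function.surjInv_eq (qY.surjective _), Function.surjInv_eq (qY.surjective _)]

theorem pairing_proj (left : ∀ V W x y, qX.proj V x = 0 → qS.pairingAux ψ V W x y = 0)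
    (right : ∀ V W x y, qY.proj W y = 0 → qS.pairingAux ψ V W x y = 0) {V W : DivPow k d}
    (x : ⨂[k]^d V.carrier) (y : ⨂[k]^d W.carrier) :
    (qX.pairing qY qS ψ left right).toFun (qX.proj V x) (qY.proj W y) =
      qS.pairingAux ψ V W x y :=
  pairingAux_congr left right (Function.surjInv_eq (qX.surjective _) _)
    (Function.surjInv_eq (qY.surjective _) _)

/-- The diagonal kills every summand except ρ = 1. The generator of `S` is thus recovered from the
pairing, which gives uniqueness in the universal property. -/
theorem act_diagonal_pairing
    (left : ∀ V W x y, qX.proj V x = 0 → qS.pairingAux ψ V W x y = 0)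
    (right : ∀ V W x y, qY.proj W y = 0 → qS.pairingAux ψ V W x y = 0) (hψ : ψ 1 = 1) :
    S.act (diagonal k d) ((qX.pairing qY qS ψ left right).toFun qX.generator qY.generator) =
      qS.generator := by
  rw [generator, generator, pairing_proj, pairingAux_apply, map_sum, Finset.sum_eq_single 1]
  · rw [map_smul, ← qS.natural, diagonal, tensor_diagHom]
    refine (congrArg (fun t => _ • qS.proj (stdObj k d) t)
      (diagMap_interleave_basisTensor (1 : Equiv.Perm (Fin d)))).trans ?_
    rw [if_pos rfl, inv_one, hψ, one_smul]
    rfl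
  · intro ρ _ hρ
    rw [map_smul, ← qS.natural, diagonal, tensor_diagHom]
    refine (congrArg (fun t => _ • qS.proj (stdObj k d) t)
      (diagMap_interleave_basisTensor ρ)).trans ?_
    rw [if_neg hρ, map_zero, smul_zero]
  · exact fun h => absurd (Finset.mem_univ _) h

/-- A morphism out of a quotient of the tensor power functor is determined by the image of the
generator, and the tensor relations of the quotient are the only constraint on it. -/
theorem exists_hom (qS : TensorQuotient S) (ζ : Z.obj.obj (stdObj k d))
    (h : ∀ V x, qS.proj V x = 0 → Z.act (classify V x) ζ = 0) :
    ∃ m : S ⟶ Z, ∀ V x, comp m V (qS.proj V x) = Z.act (classify V x) ζ := by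
  let g (V : DivPow k d) : (⨂[k]^d V.carrier) →ₗ[k] Z.obj.obj V :=
    (Z.actₗ.flip ζ) ∘ₗ classify V
  let m (V : DivPow k d) : S.obj.obj V →ₗ[k] Z.obj.obj V :=
    ((LinearMap.ker (qS.proj V)).liftQ (g V) (fun x hx => h V x hx)) ∘ₗ
      ((qS.proj V).quotKerEquivOfSurjective (qS.surjective V)).symm.toLinearMap
  have hm (V : DivPow k d) (x : ⨂[k]^d V.carrier) : m V (qS.proj V x) = g V x := by
    have : ((qS.proj V).quotKerEquivOfSurjective (qS.surjective V)).symm (qS.proj V x) =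
        Submodule.Quotient.mk x := by
      rw [LinearEquiv.symm_apply_eq]
      rfl
    simp only [m, LinearMap.comp_apply, LinearEquiv.coe_coe, this]
    rfl
  refine ⟨mkHom m fun {V W} f x => ?_, fun V x => hm V x⟩
  obtain ⟨x, rfl⟩ := qS.surjective V x
  rw [← qS.natural, hm, hm]
  change Z.act (classify W _) ζ = Z.act f (Z.act (classify V x) ζ)
  rw [← classify_comp, act_comp]

theorem hom_ext_generator (qS : TensorQuotient S) {m n : S ⟶ Z}
    (h : comp m _ qS.generator = comp n _ qS.generator) : m = n :=
  hom_ext_comp fun V x => by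
    obtain ⟨x, rfl⟩ := qS.surjective V x
    rw [← act_classify_generator, comp_act, comp_act, h]

/-- The element ζ obtained from a pairing `z` is χψ-equivariant, so x ↦ Z(`classify V x`) ζ is an
equivariant map on V^{⊗ d}. Hypothesis `hS` says that `S` has no relations beyond those such maps
respect, so ζ defines a morphism S → Z. -/
theorem pairing_isUniversal (hX : qX.ActsBy χ) (hY : qY.ActsBy ψ)
    (left : ∀ V W x y, qX.proj V x = 0 → qS.pairingAux ψ V W x y = 0)
    (right : ∀ V W x y, qY.proj W y = 0 → qS.pairingAux ψ V W x y = 0) (hψ : ψ 1 = 1)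
    (hS : ∀ (V : DivPow k d) (N : Type u) [AddCommGroup N] [Module k N]
      (g : (⨂[k]^d V.carrier) →ₗ[k] N),
      (∀ τ x, g (permAct k d _ τ x) = (χ τ * ψ τ) • g x) → ∀ x, qS.proj V x = 0 → g x = 0) :
    (qX.pairing qY qS ψ left right).IsUniversal := by
  intro Z z
  let z₀ := z.toFun qX.generator qY.generator
  let ζ : Z.obj.obj (stdObj k d) := Z.act (diagonal k d) z₀
  -- The diagonal map commutes with permuting the coordinates of both copies of k^d at once, so the
  -- two characters multiply.
  have hζ (τ : Equiv.Perm (Fin d)) : Z.act (permHom τ) ζ = (χ τ⁻¹ * ψ τ⁻¹) • ζ := by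
    rw [← act_comp, diagonal_permHom, act_comp, ← z.natural, hX.act_permHom, hY.act_permHom,
      z.map_smul, map_smul]
  have hact (V : DivPow k d) (τ : Equiv.Perm (Fin d)) (x : ⨂[k]^d V.carrier) :
      Z.act (classify V (permAct k d _ τ x)) ζ = (χ τ * ψ τ) • Z.act (classify V x) ζ := by
    have h := hζ τ⁻¹
    rw [inv_inv] at h
    rw [classify_permAct, act_comp, ← map_smul, ← h]
    rfl
  obtain ⟨m, hm⟩ := qS.exists_hom (Z := Z) ζ fun V x hx =>
    hS V (Z.obj.obj V) ((Z.actₗ.flip ζ) ∘ₗ classify V) (hact V) x hx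
  refine ⟨m, ?_, ?_⟩
  · ext V W x y
    obtain ⟨x, rfl⟩ := qX.surjective V x
    obtain ⟨y, rfl⟩ := qY.surjective W y
    rw [NaturalPairing.postcomp_toFun, pairing_proj, pairingAux_apply, map_sum]
    -- Both sides become sums over ρ. On the right, 1 ⊗ P_ρ applied to the value on generators
    -- contributes the scalar ψ(ρ⁻¹) that is built into `pairingAux`.
    rw [← qX.act_classify_generator x, ← qY.act_classify_generator y, z.natural, tensorHom_classify,
      act_sum]
    refine Finset.sum_congr rfl fun ρ _ => ?_
    rw [map_smul, hm, act_comp, act_comp, ← z.natural, act_id, hY.act_permHom]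
    have := z.map_smul 1 (ψ ρ⁻¹) qX.generator qY.generator
    rw [one_smul, one_mul] at this
    rw [this, map_smul, map_smul]
  · rintro n rfl
    refine qS.hom_ext_generator ?_
    have h : Z.act (diagonal k d) ((pairing qX qY qS ψ left right).postcomp n |>.toFun
        qX.generator qY.generator) = comp n _ qS.generator := by
      rw [NaturalPairing.postcomp_toFun, ← comp_act, act_diagonal_pairing left right hψ]
    -- Rewriting the generator as its own image under the morphism classified by e_1 ⊗ ⋯ ⊗ e_d
    -- brings the value of `n` into the form given by `hm`.
    refine (congrArg (comp n _) (qS.act_classify_generator (V := stdObj k d)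
      (basisTensor k d))).symm.trans ?_
    rw [comp_act, ← h]
    exact (hm _ _).symm

end TensorQuotient

end Quotients

/-! ### Symmetric and exterior powers as quotients of the tensor power functor -/

section SymWedge

open RepGamma DivPow TensorQuotient

variable {k : Type u} [CommRing k] {d : ℕ}

variable (k d) in
/-- `Sym^d` as a quotient of the tensor power functor. -/
def symQuotient : TensorQuotient (sym k d) where
  proj V := (symRelations k d V.carrier).mkQ
  surjective _ := Submodule.mkQ_surjective _
  natural _ _ := rfl

variable (k d) in
/-- `∧^d` as a quotient of the tensor power functor. -/
def wedgeQuotient : TensorQuotient (wedge k d) where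
  proj V := wedgeProj k d V.carrier
  surjective _ := wedgeProj_surjective
  natural f x := (wedgeAction_wedgeProj f x).symm

variable (k) in
/-- The sign character with values in `k`. -/
def signChar (σ : Equiv.Perm (Fin d)) : k := ((Equiv.Perm.sign σ : ℤ) : k)

theorem signChar_mul (σ τ : Equiv.Perm (Fin d)) :
    signChar k (σ * τ) = signChar k σ * signChar k τ := by
  simp [signChar]

theorem signChar_one : signChar k (1 : Equiv.Perm (Fin d)) = 1 := by
  simp [signChar]

theorem signChar_inv (σ : Equiv.Perm (Fin d)) : signChar k σ⁻¹ = signChar k σ := by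
  simp [signChar]

theorem signChar_mul_self (σ : Equiv.Perm (Fin d)) : signChar k σ * signChar k σ = 1 := by
  nth_rw 1 [← signChar_inv]
  rw [← signChar_mul, inv_mul_cancel, signChar_one]

theorem signChar_eq_one (h2 : (2 : k) = 0) (σ : Equiv.Perm (Fin d)) : signChar k σ = 1 := by
  have h : (-1 : k) = 1 := by
    rw [neg_eq_iff_add_eq_zero, one_add_one_eq_two, h2]
  rcases Int.units_eq_one_or (Equiv.Perm.sign σ) with hσ | hσ <;> simp [signChar, hσ, h]

theorem symQuotient_actsBy : (symQuotient k d).ActsBy fun _ => 1 := by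
  intro V σ x
  rw [one_smul]
  exact (Submodule.Quotient.eq _).mpr (Submodule.subset_span ⟨σ, x, rfl⟩)

theorem wedgeQuotient_actsBy : (wedgeQuotient k d).ActsBy (signChar k) := by
  intro V σ x
  change wedgeProj k d V.carrier _ = signChar k σ • wedgeProj k d V.carrier x
  induction x using tensor_induction with
  | h_add a b ha hb => simp only [map_add, ha, hb, smul_add]
  | h_smul c a ha => simp only [map_smul, ha, smul_comm c]
  | h v =>
    rw [permAct_tprod, wedgeProj_tprod, wedgeProj_tprod, ← signChar_inv]
    exact (AlternatingMap.map_perm (exteriorPower.ιMulti k d) v σ⁻¹).trans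
      (Int.cast_smul_eq_zsmul k _ _).symm

theorem eq_zero_of_symQuotient_eq_zero {V : DivPow k d} {N : Type u} [AddCommGroup N] [Module k N]
    (g : (⨂[k]^d V.carrier) →ₗ[k] N) (hg : ∀ τ x, g (permAct k d _ τ x) = g x)
    {x : ⨂[k]^d V.carrier} (hx : (symQuotient k d).proj V x = 0) : g x = 0 := by
  have h : symRelations k d V.carrier ≤ LinearMap.ker g := by
    rw [symRelations, Submodule.span_le]
    rintro _ ⟨σ, y, rfl⟩
    change g _ = 0
    rw [map_sub, hg, sub_self]
  exact h ((Submodule.Quotient.mk_eq_zero _).mp hx)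

/-- Sign-equivariance makes `g` alternating once 2 is invertible, so `g` factors through ∧^d. -/
theorem eq_zero_of_wedgeQuotient_eq_zero {V : DivPow k d} {N : Type u} [AddCommGroup N]
    [Module k N] (h2 : IsUnit (2 : k)) (g : (⨂[k]^d V.carrier) →ₗ[k] N)
    (hg : ∀ τ x, g (permAct k d _ τ x) = signChar k τ • g x)
    {x : ⨂[k]^d V.carrier} (hx : (wedgeQuotient k d).proj V x = 0) : g x = 0 := by
  let a : V.carrier [⋀^Fin d]→ₗ[k] N :=
    { g.compMultilinearMap (PiTensorProduct.tprod k) with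
      map_eq_zero_of_eq' := fun v i j hv hij => by
        change g (PiTensorProduct.tprod k v) = 0
        -- Swapping two equal entries fixes the tensor, so its image equals its own negative.
        have h := hg (Equiv.swap i j) (PiTensorProduct.tprod k v)
        have hv' : (fun l => v ((Equiv.swap i j).symm l)) = v := by
          ext l
          rw [Equiv.symm_swap, Equiv.apply_swap_eq_self hv]
        rw [permAct_tprod, hv', signChar, Equiv.Perm.sign_swap hij] at h
        have h' : (2 : k) • g (PiTensorProduct.tprod k v) = 0 := by
          rw [two_smul]
          nth_rw 1 [h]
          simp
        exact (h2.smul_eq_zero).mp h' }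
  have ha (y : ⨂[k]^d V.carrier) :
      exteriorPower.alternatingMapLinearEquiv a (wedgeProj k d V.carrier y) = g y := by
    induction y using tensor_induction with
    | h_add a b ha hb => simp only [map_add, ha, hb]
    | h_smul c a ha => simp only [map_smul, ha]
    | h v =>
      rw [wedgeProj_tprod, exteriorPower.alternatingMapLinearEquiv_apply_ιMulti]
      rfl
  rw [← ha]
  exact (congrArg _ hx).trans (map_zero _)

/-- Antisymmetrization factors through ∧^d over any ring, without dividing by 2. This is why
pairings with ∧^d are well defined even in characteristic 2. -/
theorem sum_signChar_permAct {V : DivPow k d} {x : ⨂[k]^d V.carrier}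
    (hx : (wedgeQuotient k d).proj V x = 0) :
    ∑ σ : Equiv.Perm (Fin d), signChar k σ • permAct k d V.carrier σ x = 0 :=
  (toTensorPower_wedgeProj x).symm.trans ((congrArg _ hx).trans (map_zero _))

namespace TensorQuotient

variable {S : RepGamma k d} {qS : TensorQuotient S} {V W : DivPow k d}
  {θ ψ : Equiv.Perm (Fin d) → k}

theorem pairingAux_permAct_right (hψ : ∀ σ τ, ψ (σ * τ) = ψ σ * ψ τ) (τ : Equiv.Perm (Fin d))
    (x : ⨂[k]^d V.carrier) (y : ⨂[k]^d W.carrier) :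
    qS.pairingAux ψ V W x (permAct k d _ τ y) = ψ τ • qS.pairingAux ψ V W x y := by
  rw [pairingAux_apply, pairingAux_apply, Finset.smul_sum]
  refine Fintype.sum_equiv (Equiv.mulRight τ) _ _ fun ρ => ?_
  rw [Equiv.coe_mulRight, permAct_permAct, smul_smul, ← hψ, mul_inv_rev, mul_inv_cancel_left]

/-- Since τx ⊗ ρy = τ(x ⊗ τ⁻¹ρy), the action on `S` contributes θ(τ), and reindexing the sum
contributes ψ(τ⁻¹). -/
theorem pairingAux_permAct_left (hS : qS.ActsBy θ) (hψ : ∀ σ τ, ψ (σ * τ) = ψ σ * ψ τ)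
    (τ : Equiv.Perm (Fin d)) (x : ⨂[k]^d V.carrier) (y : ⨂[k]^d W.carrier) :
    qS.pairingAux ψ V W (permAct k d _ τ x) y = (θ τ * ψ τ⁻¹) • qS.pairingAux ψ V W x y := by
  rw [pairingAux_apply, pairingAux_apply, Finset.smul_sum]
  refine (Fintype.sum_equiv (Equiv.mulLeft τ) _ _ fun ρ => ?_).symm
  rw [Equiv.coe_mulLeft, ← permAct_permAct, ← permAct_interleave, hS (tensorObj V W) τ,
    smul_smul, smul_smul, mul_inv_rev, hψ]
  congr 1
  ring

/-- For the sign character the pairing is the class of `x` tensored with the antisymmetrization of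
`y`. -/
theorem pairingAux_wedge_right (x : ⨂[k]^d V.carrier) {y : ⨂[k]^d W.carrier}
    (hy : (wedgeQuotient k d).proj W y = 0) : qS.pairingAux (signChar k) V W x y = 0 := by
  have h := congrArg (fun t => qS.proj (tensorObj V W) (interleave k d _ _ x t))
    (sum_signChar_permAct hy)
  simp only [map_sum, map_smul, map_zero] at h
  simpa only [pairingAux_apply, signChar_inv] using h

/-- When S_d acts trivially on `S`, the classes of x ⊗ ρy and ρ⁻¹x ⊗ y agree, so the
antisymmetrization can be moved onto `x`. -/
theorem pairingAux_wedge_left (hS : qS.ActsBy fun _ => 1) {x : ⨂[k]^d V.carrier}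
    (y : ⨂[k]^d W.carrier) (hx : (wedgeQuotient k d).proj V x = 0) :
    qS.pairingAux (signChar k) V W x y = 0 := by
  have h := congrArg (fun t => qS.proj (tensorObj V W) (interleave k d _ _ t y))
    (sum_signChar_permAct hx)
  simp only [map_sum, map_smul, map_zero, LinearMap.sum_apply, LinearMap.smul_apply,
    LinearMap.zero_apply] at h
  rw [pairingAux_apply, ← h]
  refine Fintype.sum_equiv (Equiv.inv _) _ _ fun ρ => ?_
  have e := hS (tensorObj V W) ρ (interleave k d V.carrier W.carrier (permAct k d _ ρ⁻¹ x) y)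
  rw [permAct_interleave, permAct_permAct, mul_inv_cancel, permAct_one, one_smul] at e
  rw [e, Equiv.inv_apply]

end TensorQuotient

/-! ### The four isomorphisms -/

variable (k d)

/-- The two signs cancel, so ζ is invariant and only the relations of coinvariants remain. -/
theorem wedge_tensor_wedge :
    Nonempty (internalTensor (wedge k d) (wedge k d) ≅ sym k d) :=
  internalTensorPairing_isUniversal.nonempty_iso
    (pairing_isUniversal (qS := symQuotient k d) wedgeQuotient_actsBy wedgeQuotient_actsBy
      (fun _ _ _ y hx => pairingAux_wedge_left symQuotient_actsBy y hx)
      (fun _ _ x _ hy => pairingAux_wedge_right x hy) signChar_one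
      fun V N _ _ g hg x hx => eq_zero_of_symQuotient_eq_zero g
        (fun τ x => by rw [hg, signChar_mul_self, one_smul]) hx)

theorem sym_tensor_sym :
    Nonempty (internalTensor (sym k d) (sym k d) ≅ sym k d) :=
  internalTensorPairing_isUniversal.nonempty_iso
    (pairing_isUniversal (qS := symQuotient k d) symQuotient_actsBy symQuotient_actsBy
      (fun V W _ y hx => eq_zero_of_symQuotient_eq_zero
        ((symQuotient k d).pairingAux _ V W |>.flip y)
        (fun τ x => by
          rw [LinearMap.flip_apply, LinearMap.flip_apply,
            pairingAux_permAct_left symQuotient_actsBy (by simp), one_mul, one_smul]) hx)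
      (fun V W x _ hy => eq_zero_of_symQuotient_eq_zero
        ((symQuotient k d).pairingAux _ V W x)
        (fun τ y => by rw [pairingAux_permAct_right (by simp), one_smul]) hy) rfl
      fun V N _ _ g hg x hx => eq_zero_of_symQuotient_eq_zero g
        (fun τ x => by rw [hg, one_mul, one_smul]) hx)

/-- Here ζ transforms by the sign, and invertibility of 2 turns sign-equivariance into the
alternating relations. -/
theorem sym_tensor_wedge_of_isUnit_two (h2 : IsUnit (2 : k)) :
    Nonempty (internalTensor (sym k d) (wedge k d) ≅ wedge k d) :=
  internalTensorPairing_isUniversal.nonempty_iso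
    (pairing_isUniversal (qS := wedgeQuotient k d) symQuotient_actsBy wedgeQuotient_actsBy
      (fun V W _ y hx => eq_zero_of_symQuotient_eq_zero
        ((wedgeQuotient k d).pairingAux _ V W |>.flip y)
        (fun τ x => by
          rw [LinearMap.flip_apply, LinearMap.flip_apply,
            pairingAux_permAct_left wedgeQuotient_actsBy signChar_mul, signChar_inv,
            signChar_mul_self, one_smul]) hx)
      (fun _ _ x _ hy => pairingAux_wedge_right x hy) signChar_one
      fun V N _ _ g hg x hx => eq_zero_of_wedgeQuotient_eq_zero h2 g
        (fun τ x => by rw [hg, one_mul]) hx)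

/-- The sign is now trivial, so ζ is only invariant, and nothing forces the class of a tensor with
repeated entries to vanish in the target. -/
theorem sym_tensor_wedge_of_two_eq_zero (h2 : (2 : k) = 0) :
    Nonempty (internalTensor (sym k d) (wedge k d) ≅ sym k d) :=
  internalTensorPairing_isUniversal.nonempty_iso
    (pairing_isUniversal (qS := symQuotient k d) symQuotient_actsBy wedgeQuotient_actsBy
      (fun V W _ y hx => eq_zero_of_symQuotient_eq_zero
        ((symQuotient k d).pairingAux _ V W |>.flip y)
        (fun τ x => by
          rw [LinearMap.flip_apply, LinearMap.flip_apply,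
            pairingAux_permAct_left symQuotient_actsBy signChar_mul, signChar_eq_one h2,
            one_mul, one_smul]) hx)
      (fun _ _ x _ hy => pairingAux_wedge_right x hy) signChar_one
      fun V N _ _ g hg x hx => eq_zero_of_symQuotient_eq_zero g
        (fun τ x => by rw [hg, signChar_eq_one h2, one_mul, one_smul]) hx)

end SymWedge

end StrictPolynomial

end

theorem proposition3p11 (k : Type u) [CommRing k] (d : ℕ) :
    Nonempty (StrictPolynomial.internalTensor (StrictPolynomial.wedge k d)
        (StrictPolynomial.wedge k d) ≅ StrictPolynomial.sym k d) ∧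
    Nonempty (StrictPolynomial.internalTensor (StrictPolynomial.sym k d)
        (StrictPolynomial.sym k d) ≅ StrictPolynomial.sym k d) ∧
    (IsUnit (2 : k) →
      Nonempty (StrictPolynomial.internalTensor (StrictPolynomial.sym k d)
        (StrictPolynomial.wedge k d) ≅ StrictPolynomial.wedge k d)) ∧
    ((2 : k) = 0 →
      Nonempty (StrictPolynomial.internalTensor (StrictPolynomial.sym k d)
        (StrictPolynomial.wedge k d) ≅ StrictPolynomial.sym k d)) :=
  ⟨StrictPolynomial.wedge_tensor_wedge k d, StrictPolynomial.sym_tensor_sym k d,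
    StrictPolynomial.sym_tensor_wedge_of_isUnit_two k d,
    StrictPolynomial.sym_tensor_wedge_of_two_eq_zero k d⟩
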